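/- Let $\mathscr Q_n$ be a non-singular quadric in $\mathrm{PG}(n,2)$ of projective index $g\ge 1$, where the projective index is the largest (projective) dimension of a subspace contained in $\mathscr Q_n$. Such a quadric is called parabolic, $\mathscr P_{2r}$, if $n=2r$; elliptic, $\mathscr E_{2r+1}$, if $n=2r+1$ and $g=r-1$; and hyperbolic, $\mathscr H_{2r+1}$, if $n=2r+1$ and $g=r$. Let $\Gamma$ be the point-graph of $\mathscr Q_n$: its vertices are the points of $\mathscr Q_n$, and two distinct points are adjacent when the line joining them is contained in $\mathscr Q_n$. Let $0\le s<g$ and let $\alpha_s$ be an $s$-dimensional subspace contained in $\mathscr Q_n$. A point of $\mathscr Q_n$ has type (i) if it lies in $\alpha_s$; type (ii) if it does not lie in $\alpha_s$ but lies in some $(s+1)$-dimensional subspace $\Pi$ with $\alpha_s\subset\Pi\subset\mathscr Q_n$; and type (iii) otherwise. Let $\mathcal X_s$ be the set of vertices of type (ii). Let $\Gamma_s$ be the graph obtained from $\Gamma$ by the Godsil–McKay construction: for every vertex $R\notin\mathcal X_s$ with exactly $\frac12|\mathcal X_s|$ neighbours in $\mathcal X_s$, delete the edges from $R$ to these neighbours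 and join $R$ to the other $\frac12|\mathcal X_s|$ vertices of $\mathcal X_s$; all other adjacencies are unchanged. In this statement, a maximal clique of $\Gamma_s$ means a clique of the largest possible size in $\Gamma_s$. For each vertex $X$ of $\Gamma_s$, the number of maximal cliques of $\Gamma_s$ containing $X$ is as follows, according to the type of $X$. An empty product equals $1$. If $\mathscr Q_n=\mathscr E_{2r+1}$: - type (i): $\prod_{i=2}^{r-s}(2^i+1)\cdot(2^{r+1}-2^{r-s+1}+1)$ if $s<g-1$, and $5(2^{r+1}-7)$ if $s=g-1$; - type (ii): $\prod_{i=2}^{r-s-1}(2^i+1)\cdot(2^{r+1}-2^{r-s}+1)$ if $s<g-1$, and $2^{r+1}-3$ if $s=g-1$; - type (iii): $\prod_{i=2}^{r-s}(2^i+1)$ if $s<g-1$, and $5$ if $s=g-1$. If $\mathscr Q_n=\mathscr H_{2r+1}$: - type (i): $\prod_{i=0}^{r-s-1}(2^i+1)\cdot(2^{r}-2^{r-s}+1)$ if $s<g-1$, and $2(2^r-1)$ if $s=g-1$; - type (ii): $\prod_{i=0}^{r-s-2}(2^i+1)\cdot(2^{r}-2^{r-s-1}+1)$ if $s<g-1$,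 and $2^r$ if $s=g-1$; - type (iii): $\prod_{i=0}^{r-s-1}(2^i+1)$ if $s<g-1$, and $2$ if $s=g-1$. If $\mathscr Q_n=\mathscr P_{2r}$: - type (i): $\prod_{i=1}^{r-s-1}(2^i+1)\cdot(2^{r}-2^{r-s}+1)$ if $s<g-1$, and $3(2^r-3)$ if $s=g-1$; - type (ii): $\prod_{i=1}^{r-s-2}(2^i+1)\cdot(2^{r}-2^{r-s-1}+1)$ if $s<g-1$, and $2^r-1$ if $s=g-1$; - type (iii): $\prod_{i=1}^{r-s-1}(2^i+1)$ if $s<g-1$, and $3$ if $s=g-1$. -/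

import Mathlib

open scoped LinearAlgebra.Projectivization

namespace BinaryQuadric

variable {V : Type*} [AddCommGroup V] [Module (ZMod 2) V]

/-- The projective subspace of `PG(V)` with underlying linear subspace `W` is contained in the
quadric `Q = 0`. (A projective subspace of dimension `k` has a linear subspace of
dimension `k + 1`.) -/
def Contained (Q : QuadraticForm (ZMod 2) V) (W : Submodule (ZMod 2) V) : Prop :=
  ∀ v ∈ W, Q v = 0

/-- The quadric `Q = 0` is non-singular: no nonzero vector `v` with `Q v = 0` is orthogonal to the
whole space under the polar form, i.e. `Q` cannot be written in fewer variables. -/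
def Nonsingular (Q : QuadraticForm (ZMod 2) V) : Prop :=
  Q.radical = ⊥

/-- The largest projective dimension of a subspace contained in the quadric is `g`.
(The zero subspace has projective dimension `-1`.) -/
def HasProjectiveIndex (Q : QuadraticForm (ZMod 2) V) (g : ℤ) : Prop :=
  IsGreatest {k : ℤ | ∃ W : Submodule (ZMod 2) V,
    Contained Q W ∧ (Module.finrank (ZMod 2) W : ℤ) = k + 1} g

/-- An elliptic quadric of `PG(2r+1, 2)`. -/
structure IsElliptic (Q : QuadraticForm (ZMod 2) V) (r : ℕ) : Prop where
  nonsingular : Nonsingular Q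
  finrank_eq : Module.finrank (ZMod 2) V = (2 * r + 1) + 1
  index : HasProjectiveIndex Q ((r : ℤ) - 1)

/-- A hyperbolic quadric of `PG(2r+1, 2)`. -/
structure IsHyperbolic (Q : QuadraticForm (ZMod 2) V) (r : ℕ) : Prop where
  nonsingular : Nonsingular Q
  finrank_eq : Module.finrank (ZMod 2) V = (2 * r + 1) + 1
  index : HasProjectiveIndex Q (r : ℤ)

/-- A parabolic quadric of `PG(2r, 2)`. -/
structure IsParabolic (Q : QuadraticForm (ZMod 2) V) (r : ℕ) : Prop where
  nonsingular : Nonsingular Q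
  finrank_eq : Module.finrank (ZMod 2) V = 2 * r + 1

/-- The points of the quadric `Q = 0` in `PG(V)`. -/
abbrev Point (Q : QuadraticForm (ZMod 2) V) : Type _ :=
  {p : ℙ (ZMod 2) V // Contained Q p.submodule}

instance finite_point [FiniteDimensional (ZMod 2) V] (Q : QuadraticForm (ZMod 2) V) :
    Finite (Point Q) := by
  have : Finite V := Module.finite_of_finite (ZMod 2)
  infer_instance

/-- The point-graph of the quadric: two distinct points are adjacent when the line joining them
is contained in the quadric. -/
def pointGraph (Q : QuadraticForm (ZMod 2) V) : SimpleGraph (Point Q) where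
  Adj p p' := p ≠ p' ∧ Contained Q (p.1.submodule ⊔ p'.1.submodule)
  symm := ⟨fun _ _ h => ⟨h.1.symm, by rw [sup_comm]; exact h.2⟩⟩
  loopless := ⟨fun _ h => h.1 rfl⟩

/-- Type (i): the points of `α`. -/
def TypeI {Q : QuadraticForm (ZMod 2) V} (α : Submodule (ZMod 2) V) (p : Point Q) : Prop :=
  p.1.submodule ≤ α

/-- Type (ii): the points not in `α` that lie in some subspace of dimension one more than that of
`α` which contains `α` and is contained in the quadric. -/
def TypeII {Q : QuadraticForm (ZMod 2) V} (α : Submodule (ZMod 2) V) (p : Point Q) : Prop :=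
  ¬ TypeI α p ∧ ∃ W : Submodule (ZMod 2) V, α ≤ W ∧ Contained Q W ∧
    Module.finrank (ZMod 2) W = Module.finrank (ZMod 2) α + 1 ∧ p.1.submodule ≤ W

/-- Type (iii): the remaining points of the quadric. -/
def TypeIII {Q : QuadraticForm (ZMod 2) V} (α : Submodule (ZMod 2) V) (p : Point Q) : Prop :=
  ¬ TypeI α p ∧ ¬ TypeII α p

/-- `y` lies outside `X` and is adjacent to exactly half of the vertices of `X`. -/
def IsHalfAdjacent {U : Type*} (G : SimpleGraph U) (X : Set U) (y : U) : Prop :=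
  y ∉ X ∧ 2 * {x | x ∈ X ∧ G.Adj y x}.ncard = X.ncard

/-- The Godsil–McKay construction for the partition of the vertices into `X` and its complement:
for every vertex `y` outside `X` that is adjacent to exactly half of `X`, the edges and
non-edges between `y` and `X` are interchanged; all other adjacencies are kept. -/
def godsilMcKay {U : Type*} (G : SimpleGraph U) (X : Set U) : SimpleGraph U where
  Adj a b :=
    let switched := (a ∈ X ∧ IsHalfAdjacent G X b) ∨ (b ∈ X ∧ IsHalfAdjacent G X a)
    (switched ∧ ¬ G.Adj a b) ∨ (¬ switched ∧ G.Adj a b)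
  symm := ⟨by
    intro a b h
    simp only [G.adj_comm b a]
    rw [or_comm (a := b ∈ X ∧ _)]
    exact h⟩
  loopless := ⟨by
    rintro a (⟨⟨h, h'⟩ | ⟨h, h'⟩, -⟩ | ⟨-, h⟩)
    · exact h'.1 h
    · exact h'.1 h
    · exact G.loopless.irrefl a h⟩

/-- The graph `Γ_s`, built from the point-graph and a subspace `α` contained in the quadric. -/
def switchedGraph (Q : QuadraticForm (ZMod 2) V) (α : Submodule (ZMod 2) V) :
    SimpleGraph (Point Q) :=
  godsilMcKay (pointGraph Q) {p | TypeII α p}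

/-- The number of cliques of `Γ_s` of maximum size through the vertex `x`. -/
noncomputable def numMaxCliquesThrough [FiniteDimensional (ZMod 2) V]
    (Q : QuadraticForm (ZMod 2) V) (α : Submodule (ZMod 2) V) (x : Point Q) : ℕ :=
  {C : Finset (Point Q) | (switchedGraph Q α).IsMaximumClique C ∧ x ∈ C}.ncard

end BinaryQuadric

/-!
Write `m = g + 1` for the Witt index, `dim V = 2 m + δ` (so `δ = 2, 0, 1` in the elliptic,
hyperbolic and parabolic case), and call a subspace of linear dimension `m` contained in the
quadric a generator. A point is of type (i), (ii) or (iii) according as its vector lies in `α`, in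
`α^⊥ \ α`, or outside `α^⊥`. The vertices that get switched are those of type (iii), since
translation by a vector of `α` not orthogonal to such a point pairs its neighbours of type (ii) with
its non-neighbours. Hence a set of points is a clique of the switched graph when the polar form
takes the value `1` between types (ii) and (iii) and `0` otherwise.

*Maximum cliques.* A clique without points of type (iii) spans, together with `α`, a subspace of the
quadric. In a clique with points of type (iii), either all of these induce the same functional
on `α`; then translating the points of type (ii) by some `t ∈ α` makes the clique pairwise
orthogonal (`IsSwitchedClique.contained_span_shift`). Or two of them differ on `α`; then the clique
injects into a subspace of the quadric with no image of type (ii)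
(`IsSwitchedClique.exists_injOn_of_add_notMem_perp`), and it is not maximum because every generator
contains vectors of type (ii). So the maximum cliques have `2 ^ m - 1` points and correspond to the
generators containing `α` and to the generators `W` meeting `α` in a hyperplane of `α`, the latter
through the clique `switchedGenerator Q α W` (`isMaximumClique_switchedGraph_iff`,
`numMaxCliquesThrough_eq`).

*Counting.* A character sum gives the number of singular vectors of `β^⊥` for `β` contained in the
quadric, and a double count then gives `∏ i < m - dim β, (2 ^ (δ + i) + 1)` generators through `β`
(`ncard_generatorsThrough`). The generators of the second kind attached to a vertex are counted by
their intersection `K` with `α`: given `K`, they are the generators through a subspace `β`, except,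
for types (i) and (ii), those through a larger subspace `γ` with `dim γ = dim β + 1`.
-/

namespace BinaryQuadric

variable {V : Type*} [AddCommGroup V] [Module (ZMod 2) V]

/-! ### The polar form and subspaces of the quadric -/

/-- The subspace of vectors orthogonal to `W` under the polar form of `Q`. -/
def perp (Q : QuadraticForm (ZMod 2) V) (W : Submodule (ZMod 2) V) : Submodule (ZMod 2) V :=
  LinearMap.BilinForm.orthogonal (QuadraticMap.polarBilin Q) W

/-- The largest (linear) dimension of a subspace contained in the quadric is `m`. -/
structure HasWittIndex (Q : QuadraticForm (ZMod 2) V) (m : ℕ) : Prop where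
  exists_contained : ∃ W, Contained Q W ∧ Module.finrank (ZMod 2) W = m
  finrank_le : ∀ W, Contained Q W → Module.finrank (ZMod 2) W ≤ m

/-- The subspaces of linear dimension `m` that are contained in the quadric and contain `β`.
If `m` is the Witt index, these are the generators through `β`. -/
def generatorsThrough (Q : QuadraticForm (ZMod 2) V) (m : ℕ) (β : Submodule (ZMod 2) V) :
    Set (Submodule (ZMod 2) V) :=
  {W | (Contained Q W ∧ Module.finrank (ZMod 2) W = m) ∧ β ≤ W}

theorem mem_generatorsThrough {Q : QuadraticForm (ZMod 2) V} {m : ℕ}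
    {β W : Submodule (ZMod 2) V} : W ∈ generatorsThrough Q m β ↔
      (Contained Q W ∧ Module.finrank (ZMod 2) W = m) ∧ β ≤ W := Iff.rfl

section Basic

variable {Q : QuadraticForm (ZMod 2) V}

theorem mem_perp {W : Submodule (ZMod 2) V} {v : V} :
    v ∈ perp Q W ↔ ∀ w ∈ W, QuadraticMap.polar Q w v = 0 := Iff.rfl

theorem mem_perp' {W : Submodule (ZMod 2) V} {v : V} :
    v ∈ perp Q W ↔ ∀ w ∈ W, QuadraticMap.polar Q v w = 0 := by
  simp only [mem_perp, QuadraticMap.polar_comm Q v]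

theorem add_self_eq_zero' (v : V) : v + v = 0 := ZModModule.add_self v

theorem polar_self_eq_zero (v : V) : QuadraticMap.polar Q v v = 0 := by
  rw [QuadraticMap.polar, add_self_eq_zero', QuadraticMap.map_zero, zero_sub]
  generalize Q v = a
  revert a; decide

theorem zmod_two_ne_zero_iff {a : ZMod 2} : a ≠ 0 ↔ a = 1 := by
  revert a; decide

theorem map_add_eq (v w : V) : Q (v + w) = Q v + Q w + QuadraticMap.polar Q v w :=
  QuadraticMap.map_add Q v w

theorem Contained.polar_eq_zero {W : Submodule (ZMod 2) V} (hW : Contained Q W) {v w : V}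
    (hv : v ∈ W) (hw : w ∈ W) : QuadraticMap.polar Q v w = 0 := by
  rw [QuadraticMap.polar, hW _ (W.add_mem hv hw), hW _ hv, hW _ hw]; rfl

theorem Contained.le_perp {W : Submodule (ZMod 2) V} (hW : Contained Q W) : W ≤ perp Q W :=
  fun _ hv _ hw => hW.polar_eq_zero hw hv

theorem Contained.mono {U W : Submodule (ZMod 2) V} (hW : Contained Q W) (h : U ≤ W) :
    Contained Q U := fun v hv => hW v (h hv)

theorem Contained.sup {U W : Submodule (ZMod 2) V} (hU : Contained Q U) (hW : Contained Q W)
    (h : W ≤ perp Q U) : Contained Q (U ⊔ W) := by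
  intro v hv
  obtain ⟨u, hu, w, hw, rfl⟩ := Submodule.mem_sup.1 hv
  rw [map_add_eq, hU u hu, hW w hw, mem_perp.1 (h hw) u hu]; rfl

theorem perp_anti {U W : Submodule (ZMod 2) V} (h : U ≤ W) : perp Q W ≤ perp Q U :=
  fun _ hv u hu => hv u (h hu)

theorem mem_span_singleton_iff {v w : V} :
    w ∈ Submodule.span (ZMod 2) {v} ↔ w = 0 ∨ w = v := by
  rw [Submodule.mem_span_singleton]
  constructor
  · rintro ⟨a, rfl⟩
    rcases (show a = 0 ∨ a = 1 by revert a; decide) with rfl | rfl <;> simp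
  · rintro (rfl | rfl)
    · exact ⟨0, by simp⟩
    · exact ⟨1, by simp⟩

theorem contained_span_singleton {v : V} (hv : Q v = 0) :
    Contained Q (Submodule.span (ZMod 2) {v}) := by
  intro w hw
  rcases mem_span_singleton_iff.1 hw with rfl | rfl
  · exact QuadraticMap.map_zero Q
  · exact hv

theorem span_singleton_le_perp {U : Submodule (ZMod 2) V} {v : V} (hv : v ∈ perp Q U) :
    Submodule.span (ZMod 2) {v} ≤ perp Q U := by
  rwa [Submodule.span_singleton_le_iff_mem]

theorem Contained.sup_singleton {U : Submodule (ZMod 2) V} (hU : Contained Q U) {v : V}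
    (hv : Q v = 0) (h : v ∈ perp Q U) : Contained Q (U ⊔ Submodule.span (ZMod 2) {v}) :=
  hU.sup (contained_span_singleton hv) (span_singleton_le_perp h)

/-- Pairwise orthogonal singular vectors span a subspace contained in the quadric. -/
theorem contained_span {S : Set V} (h0 : ∀ v ∈ S, Q v = 0)
    (h : ∀ v ∈ S, ∀ w ∈ S, QuadraticMap.polar Q v w = 0) :
    Contained Q (Submodule.span (ZMod 2) S) := by
  have h1 : Submodule.span (ZMod 2) S ≤ perp Q (Submodule.span (ZMod 2) S) := by
    have h2 : S ⊆ perp Q (Submodule.span (ZMod 2) S) := by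
      intro v hv
      have : Submodule.span (ZMod 2) S ≤ perp Q (Submodule.span (ZMod 2) {v}) := by
        rw [Submodule.span_le]
        intro w hw u hu
        rcases mem_span_singleton_iff.1 hu with rfl | rfl
        · simp
        · exact h _ hv _ hw
      exact mem_perp'.2 fun w hw =>
        mem_perp.1 (this hw) v (Submodule.mem_span_singleton_self v)
    rwa [Submodule.span_le]
  intro v hv
  induction hv using Submodule.span_induction with
  | mem x hx => exact h0 x hx
  | zero => exact QuadraticMap.map_zero Q
  | add x y hx hy h2 h3 => rw [map_add_eq, h2, h3, mem_perp.1 (h1 hy) x hx]; rfl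
  | smul a x hx h2 => rw [QuadraticMap.map_smul, h2, smul_zero]

end Basic

section Finite

variable [FiniteDimensional (ZMod 2) V] {Q : QuadraticForm (ZMod 2) V}

theorem card_submodule (W : Submodule (ZMod 2) V) :
    Nat.card W = 2 ^ Module.finrank (ZMod 2) W := by
  rw [Module.natCard_eq_pow_finrank (K := ZMod 2), Nat.card_zmod]

theorem ncard_submodule (W : Submodule (ZMod 2) V) :
    (W : Set V).ncard = 2 ^ Module.finrank (ZMod 2) W := by
  rw [← card_submodule W]; rfl

theorem finrank_sup_singleton {U : Submodule (ZMod 2) V} {v : V} (hv : v ∉ U) :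
    Module.finrank (ZMod 2) ↥(U ⊔ Submodule.span (ZMod 2) {v}) =
      Module.finrank (ZMod 2) U + 1 := by
  have h := Submodule.finrank_sup_add_finrank_inf_eq U (Submodule.span (ZMod 2) {v})
  have h1 : U ⊓ Submodule.span (ZMod 2) {v} = ⊥ := by
    rw [eq_bot_iff]
    rintro w ⟨hw, hw'⟩
    rcases mem_span_singleton_iff.1 hw' with rfl | rfl
    · simp
    · exact absurd hw hv
  have h2 : v ≠ 0 := by rintro rfl; exact hv U.zero_mem
  rw [h1, finrank_bot, finrank_span_singleton h2] at h
  omega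

/-- In a nonsingular quadric space, a subspace contained in the quadric meets the radical of
the polar form trivially, so its perp has the expected dimension. -/
theorem finrank_add_finrank_perp (hQ : Nonsingular Q) {W : Submodule (ZMod 2) V}
    (hW : Contained Q W) :
    Module.finrank (ZMod 2) W + Module.finrank (ZMod 2) (perp Q W) =
      Module.finrank (ZMod 2) V := by
  have h := LinearMap.BilinForm.finrank_add_finrank_orthogonal'
    (B := (QuadraticMap.polarBilin Q : LinearMap.BilinForm (ZMod 2) V)) W
  have h1 : W ⊓ LinearMap.ker (QuadraticMap.polarBilin Q : LinearMap.BilinForm (ZMod 2) V)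
      = ⊥ := by
    rw [eq_bot_iff, ← hQ]
    rintro w ⟨hw, hw'⟩
    exact ⟨hW w hw, hw'⟩
  have h2 : Module.finrank (ZMod 2) ↥(W ⊓ LinearMap.ker
      (QuadraticMap.polarBilin Q : LinearMap.BilinForm (ZMod 2) V)) = 0 := by
    rw [h1, finrank_bot]
  exact h.trans (by rw [h2, add_zero])

/-- The functionals that `W` induces on `U` vanish on `U ⊓ W`, which bounds their number. -/
theorem finrank_add_finrank_inf_le (hQ : Nonsingular Q) {U W : Submodule (ZMod 2) V}
    (hU : Contained Q U) (hW : Contained Q W) :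
    Module.finrank (ZMod 2) W + Module.finrank (ZMod 2) ↥(U ⊓ W) ≤
      Module.finrank (ZMod 2) ↥(W ⊓ perp Q U) + Module.finrank (ZMod 2) U := by
  have h1 := Submodule.finrank_sup_add_finrank_inf_eq W (perp Q U)
  have h2 : W ⊔ perp Q U ≤ perp Q (U ⊓ W) :=
    sup_le (hW.le_perp.trans (perp_anti inf_le_right)) (perp_anti inf_le_left)
  have h3 := Submodule.finrank_mono h2
  have h4 := finrank_add_finrank_perp hQ hU
  have h5 := finrank_add_finrank_perp hQ (hU.mono (inf_le_left : U ⊓ W ≤ U))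
  omega

theorem exists_mem_generatorsThrough (hQ : Nonsingular Q) {m : ℕ} (hm : HasWittIndex Q m)
    {U : Submodule (ZMod 2) V} (hU : Contained Q U) : (generatorsThrough Q m U).Nonempty := by
  obtain ⟨W, hW, hWm⟩ := hm.exists_contained
  have hc : Contained Q (U ⊔ W ⊓ perp Q U) := hU.sup (hW.mono inf_le_left) inf_le_right
  refine ⟨_, ⟨hc, le_antisymm (hm.finrank_le _ hc) ?_⟩, le_sup_left⟩
  have h1 := finrank_add_finrank_inf_le hQ hU hW
  have h2 := Submodule.finrank_sup_add_finrank_inf_eq U (W ⊓ perp Q U)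
  have h3 : Module.finrank (ZMod 2) ↥(U ⊓ (W ⊓ perp Q U)) ≤ Module.finrank (ZMod 2) ↥(U ⊓ W) :=
    Submodule.finrank_mono (inf_le_inf_left _ inf_le_left)
  omega

/-- A singular vector orthogonal to a generator lies in it. -/
theorem HasWittIndex.mem_of_mem_perp {m : ℕ} (hm : HasWittIndex Q m)
    {W : Submodule (ZMod 2) V} (hW : Contained Q W) (hWm : Module.finrank (ZMod 2) W = m)
    {v : V} (hv : Q v = 0) (hvW : v ∈ perp Q W) : v ∈ W := by
  by_contra h
  have h1 := hm.finrank_le _ (hW.sup_singleton hv hvW)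
  rw [finrank_sup_singleton h] at h1
  omega

/-- The perp of a generator exceeds it by at most two dimensions: it is anisotropic modulo the
generator. -/
theorem HasWittIndex.finrank_le_add_two (hQ : Nonsingular Q) {m : ℕ} (hm : HasWittIndex Q m) :
    Module.finrank (ZMod 2) V ≤ 2 * m + 2 := by
  obtain ⟨W, hW, hWm⟩ := hm.exists_contained
  by_contra! hlt
  have h1 := finrank_add_finrank_perp hQ hW
  have key : ∀ v ∈ perp Q W, v ∉ W → Q v = 1 := fun v hv hvW =>
    zmod_two_ne_zero_iff.1 fun h => hvW (hm.mem_of_mem_perp hW hWm h hv)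
  have step : ∀ U : Submodule (ZMod 2) V, Module.finrank (ZMod 2) U < m + 3 →
      ∃ v ∈ perp Q W, v ∉ U := by
    intro U hU
    by_contra! h
    have := Submodule.finrank_mono (show perp Q W ≤ U from h)
    omega
  obtain ⟨u, hu, huW⟩ := step W (by omega)
  have hf1 := finrank_sup_singleton huW
  obtain ⟨v, hv, hvW⟩ := step (W ⊔ Submodule.span (ZMod 2) {u}) (by omega)
  have hf2 := finrank_sup_singleton hvW
  obtain ⟨w, hw, hwW⟩ :=
    step (W ⊔ Submodule.span (ZMod 2) {u} ⊔ Submodule.span (ZMod 2) {v}) (by omega)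
  have hvW' : v ∉ W := fun h => hvW (Submodule.mem_sup_left h)
  have huv : u + v ∉ W := fun h => hvW (by
    have : v = (u + v) + u := by rw [add_right_comm, add_self_eq_zero', zero_add]
    rw [this]
    exact Submodule.add_mem_sup h (Submodule.mem_span_singleton_self u))
  have hwW' : w ∉ W := fun h => hwW (Submodule.mem_sup_left (Submodule.mem_sup_left h))
  have huw : u + w ∉ W := fun h => hwW (by
    have : w = (u + w) + u := by rw [add_right_comm, add_self_eq_zero', zero_add]
    rw [this]
    exact Submodule.mem_sup_left
      (Submodule.add_mem_sup h (Submodule.mem_span_singleton_self u)))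
  have hvw : v + w ∉ W := fun h => hwW (by
    have : w = (v + w) + v := by rw [add_right_comm, add_self_eq_zero', zero_add]
    rw [this]
    exact Submodule.add_mem_sup (Submodule.mem_sup_left h)
      (Submodule.mem_span_singleton_self v))
  have huvw : u + (v + w) ∉ W := fun h => hwW (by
    have : w = (u + (v + w)) + u + v := by
      have hu' := add_self_eq_zero' u
      have hv' := add_self_eq_zero' v
      calc w = (u + u) + (v + v) + w := by rw [hu', hv', zero_add, zero_add]
        _ = _ := by abel
    rw [this]
    exact Submodule.add_mem_sup
      (Submodule.add_mem_sup h (Submodule.mem_span_singleton_self u))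
      (Submodule.mem_span_singleton_self v))
  have qu := key u hu huW
  have qv := key v hv hvW'
  have qw := key w hw hwW'
  have quv := key _ ((perp Q W).add_mem hu hv) huv
  have quw := key _ ((perp Q W).add_mem hu hw) huw
  have qvw := key _ ((perp Q W).add_mem hv hw) hvw
  have quvw := key _ ((perp Q W).add_mem hu ((perp Q W).add_mem hv hw)) huvw
  rw [map_add_eq, QuadraticMap.polar_add_right, qu, qvw] at quvw
  rw [map_add_eq, qu, qv] at quv
  rw [map_add_eq, qu, qw] at quw
  revert quv quw quvw
  generalize QuadraticMap.polar Q u v = a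
  generalize QuadraticMap.polar Q u w = b
  revert a b
  decide

end Finite

/-! ### Counting generators -/

/-- The nontrivial additive character of `ZMod 2`, with values in `ℤ`. -/
def signChar (a : ZMod 2) : ℤ := if a = 0 then 1 else -1

theorem signChar_add (a b : ZMod 2) : signChar (a + b) = signChar a * signChar b := by
  revert a b; decide

section Count

variable [FiniteDimensional (ZMod 2) V] {Q : QuadraticForm (ZMod 2) V}

open Classical in
/-- Averaging over translations by a generator `M` through `β` reduces the character sum of `Q`
over `β^⊥` to `M^⊥`, where `Q` vanishes exactly on `M`. -/
theorem sum_signChar_perp [Fintype V] {m : ℕ} (hm : HasWittIndex Q m)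
    {β M : Submodule (ZMod 2) V} (hM : Contained Q M) (hMm : Module.finrank (ZMod 2) M = m)
    (hβ : β ≤ M) :
    ∑ v with v ∈ perp Q β, signChar (Q v) =
      2 * (M : Set V).ncard - (perp Q M : Set V).ncard := by
  have hMβ : M ≤ perp Q β := hM.le_perp.trans (perp_anti hβ)
  have hcard : ((M : Set V).ncard : ℤ) = ∑ w with w ∈ M, (1 : ℤ) := by
    rw [Finset.sum_const, nsmul_eq_mul, mul_one, Set.ncard_eq_toFinset_card']
    congr 2; ext; simp
  have hcard' : ((perp Q M : Set V).ncard : ℤ) = ∑ w with w ∈ perp Q M, (1 : ℤ) := by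
    rw [Finset.sum_const, nsmul_eq_mul, mul_one, Set.ncard_eq_toFinset_card']
    congr 2; ext; simp
  have hMpos : ((M : Set V).ncard : ℤ) ≠ 0 := by rw [ncard_submodule]; positivity
  have htrans : ∀ w ∈ M, ∑ v with v ∈ perp Q β, signChar (Q (v + w)) =
      ∑ v with v ∈ perp Q β, signChar (Q v) := by
    intro w hw
    refine Finset.sum_bij' (fun v _ => v + w) (fun v _ => v + w) ?_ ?_ ?_ ?_ ?_
    · intro v hv
      simpa using (perp Q β).add_mem (Finset.mem_filter.1 hv).2 (hMβ hw)
    · intro v hv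
      simpa using (perp Q β).add_mem (Finset.mem_filter.1 hv).2 (hMβ hw)
    · intro v _
      rw [add_assoc, add_self_eq_zero', add_zero]
    · intro v _
      rw [add_assoc, add_self_eq_zero', add_zero]
    · intro v _; rfl
  have hchar : ∀ v, ∑ w with w ∈ M, signChar (QuadraticMap.polar Q v w) =
      if v ∈ perp Q M then ((M : Set V).ncard : ℤ) else 0 := by
    intro v
    split_ifs with hv
    · rw [hcard]
      refine Finset.sum_congr rfl fun w hw => ?_
      rw [mem_perp'.1 hv w (Finset.mem_filter.1 hw).2]; rfl
    · rw [mem_perp'] at hv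
      push Not at hv
      obtain ⟨w₀, hw₀, hne⟩ := hv
      have h1 : ∑ w with w ∈ M, signChar (QuadraticMap.polar Q v w) =
          ∑ w with w ∈ M, - signChar (QuadraticMap.polar Q v w) := by
        refine Finset.sum_bij' (fun w _ => w + w₀) (fun w _ => w + w₀) ?_ ?_ ?_ ?_ ?_
        · intro w hw
          simpa using M.add_mem (Finset.mem_filter.1 hw).2 hw₀
        · intro w hw
          simpa using M.add_mem (Finset.mem_filter.1 hw).2 hw₀
        · intro w _
          rw [add_assoc, add_self_eq_zero', add_zero]
        · intro w _
          rw [add_assoc, add_self_eq_zero', add_zero]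
        · intro w _
          rw [QuadraticMap.polar_add_right, zmod_two_ne_zero_iff.1 hne, signChar_add]
          simp [signChar]
      rw [Finset.sum_neg_distrib] at h1
      linarith
  have h1 : ((M : Set V).ncard : ℤ) * ∑ v with v ∈ perp Q β, signChar (Q v) =
      ((M : Set V).ncard : ℤ) * ∑ v with v ∈ perp Q M, signChar (Q v) := by
    calc _ = ∑ w with w ∈ M, ∑ v with v ∈ perp Q β, signChar (Q (v + w)) := by
          rw [hcard, Finset.sum_mul]
          refine Finset.sum_congr rfl fun w hw => ?_
          rw [one_mul, htrans w (Finset.mem_filter.1 hw).2]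
      _ = ∑ v with v ∈ perp Q β, signChar (Q v) *
            ∑ w with w ∈ M, signChar (QuadraticMap.polar Q v w) := by
          rw [Finset.sum_comm]
          refine Finset.sum_congr rfl fun v _ => ?_
          rw [Finset.mul_sum]
          refine Finset.sum_congr rfl fun w hw => ?_
          rw [map_add_eq, hM w (Finset.mem_filter.1 hw).2, add_zero, signChar_add]
      _ = _ := by
          simp_rw [hchar, mul_ite, mul_zero]
          rw [← Finset.sum_filter, Finset.filter_filter, Finset.mul_sum]
          refine Finset.sum_congr ?_ fun v _ => mul_comm _ _
          ext v
          simp only [Finset.mem_filter, Finset.mem_univ, true_and]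
          exact ⟨fun h => h.2, fun h => ⟨perp_anti hβ h, h⟩⟩
  rw [mul_right_inj' hMpos] at h1
  rw [h1, hcard, hcard', Finset.mul_sum]
  have h2 : ∀ v ∈ Finset.univ.filter (· ∈ perp Q M),
      signChar (Q v) = (if v ∈ M then 2 else 0) - 1 := by
    intro v hv
    have hv' := (Finset.mem_filter.1 hv).2
    split_ifs with h
    · rw [hM v h]; rfl
    · rw [zmod_two_ne_zero_iff.1 fun h0 => h (hm.mem_of_mem_perp hM hMm h0 hv')]; rfl
  rw [Finset.sum_congr rfl h2, Finset.sum_sub_distrib, ← Finset.sum_filter,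
    Finset.filter_filter, mul_one]
  congr 2
  ext v
  simp only [Finset.mem_filter, Finset.mem_univ, true_and]
  exact ⟨fun h => h.2, fun h => ⟨hM.le_perp h, h⟩⟩

/-- The number of singular vectors in `β^⊥ \ β`, for `β` of dimension `m - (j + 1)`. -/
theorem ncard_singular_perp_diff (hQ : Nonsingular Q) {m δ : ℕ} (hm : HasWittIndex Q m)
    (hδ : Module.finrank (ZMod 2) V = 2 * m + δ) {β : Submodule (ZMod 2) V}
    (hβ : Contained Q β) {j : ℕ} (hj : Module.finrank (ZMod 2) β + (j + 1) = m) :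
    {v : V | (v ∈ perp Q β ∧ Q v = 0) ∧ v ∉ β}.ncard =
      2 ^ Module.finrank (ZMod 2) β * ((2 ^ (j + 1) - 1) * (2 ^ (δ + j) + 1)) := by
  classical
  have : Finite V := Module.finite_of_finite (ZMod 2)
  have : Fintype V := Fintype.ofFinite V
  obtain ⟨M, ⟨hM, hMm⟩, hβM⟩ := exists_mem_generatorsThrough hQ hm hβ
  have hsum := sum_signChar_perp hm hM hMm hβM
  set k := Module.finrank (ZMod 2) β with hk
  have h1 := finrank_add_finrank_perp hQ hM
  have h2 := finrank_add_finrank_perp hQ hβ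
  have e1 : Module.finrank (ZMod 2) (perp Q M) = k + (j + 1) + δ := by omega
  have e2 : Module.finrank (ZMod 2) (perp Q β) = k + 2 * (j + 1) + δ := by omega
  rw [ncard_submodule, ncard_submodule, hMm, e1, ← hj] at hsum
  have hP : ((perp Q β : Set V).ncard : ℤ) = ∑ w with w ∈ perp Q β, (1 : ℤ) := by
    rw [Finset.sum_const, nsmul_eq_mul, mul_one, Set.ncard_eq_toFinset_card']
    congr 2; ext; simp
  have hS : ({v : V | v ∈ perp Q β ∧ Q v = 0}.ncard : ℤ) =
      ∑ w with w ∈ perp Q β, if Q w = 0 then (1 : ℤ) else 0 := by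
    rw [← Finset.sum_filter, Finset.filter_filter, Finset.sum_const, nsmul_eq_mul, mul_one,
      Set.ncard_eq_toFinset_card']
    congr 2; ext; simp
  have h3 : (2 * {v : V | v ∈ perp Q β ∧ Q v = 0}.ncard : ℤ) =
      (perp Q β : Set V).ncard + ∑ v with v ∈ perp Q β, signChar (Q v) := by
    rw [hP, hS, ← Finset.sum_add_distrib, Finset.mul_sum]
    refine Finset.sum_congr rfl fun v _ => ?_
    unfold signChar
    split_ifs <;> norm_num
  rw [hsum, ncard_submodule, e2] at h3
  have h4 : {v : V | (v ∈ perp Q β ∧ Q v = 0) ∧ v ∉ β}.ncard + 2 ^ k =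
      {v : V | v ∈ perp Q β ∧ Q v = 0}.ncard := by
    rw [hk, ← ncard_submodule]
    refine Set.ncard_sdiff_add_ncard_of_subset (t := {v : V | v ∈ perp Q β ∧ Q v = 0}) ?_
    exact fun v hv => ⟨hβ.le_perp hv, hβ v hv⟩
  have h5 : 1 ≤ 2 ^ (j + 1) := Nat.one_le_two_pow
  zify [h5] at h4 ⊢
  push_cast at h3
  have h6 : (2 : ℤ) * {v : V | (v ∈ perp Q β ∧ Q v = 0) ∧ v ∉ β}.ncard =
      2 * (2 ^ k * ((2 ^ (j + 1) - 1) * (2 ^ (δ + j) + 1))) := by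
    rw [show (2 : ℤ) * {v : V | (v ∈ perp Q β ∧ Q v = 0) ∧ v ∉ β}.ncard =
      2 * {v : V | v ∈ perp Q β ∧ Q v = 0}.ncard - 2 * 2 ^ k by linarith, h3]
    ring
  exact mul_left_cancel₀ two_ne_zero h6

/-- The number of generators through a subspace contained in the quadric, by induction on its
codimension `j` in a generator, counting pairs of a singular point and a generator through it. -/
theorem ncard_generatorsThrough (hQ : Nonsingular Q) {m δ : ℕ} (hm : HasWittIndex Q m)
    (hδ : Module.finrank (ZMod 2) V = 2 * m + δ) {β : Submodule (ZMod 2) V}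
    (hβ : Contained Q β) {j : ℕ} (hj : Module.finrank (ZMod 2) β + j = m) :
    (generatorsThrough Q m β).ncard = ∏ i ∈ Finset.range j, (2 ^ (δ + i) + 1) := by
  classical
  have : Finite V := Module.finite_of_finite (ZMod 2)
  have : Fintype V := Fintype.ofFinite V
  have : Fintype (Submodule (ZMod 2) V) := Fintype.ofFinite _
  induction j generalizing β with
  | zero =>
    have : generatorsThrough Q m β = {β} := by
      ext W
      constructor
      · rintro ⟨⟨hW, hWm⟩, h⟩
        exact (Submodule.eq_of_le_of_finrank_eq h (by omega)).symm
      · rintro rfl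
        exact ⟨⟨hβ, by omega⟩, le_rfl⟩
    rw [this]; simp
  | succ j ih =>
    have hcount := Finset.card_mul_eq_card_mul
      (s := {v : V | (v ∈ perp Q β ∧ Q v = 0) ∧ v ∉ β}.toFinset)
      (t := (generatorsThrough Q m β).toFinset) (fun v W => v ∈ W)
      (m := ∏ i ∈ Finset.range j, (2 ^ (δ + i) + 1))
      (n := 2 ^ Module.finrank (ZMod 2) β * (2 ^ (j + 1) - 1)) ?_ ?_
    · rw [← Set.ncard_eq_toFinset_card', ← Set.ncard_eq_toFinset_card',
        ncard_singular_perp_diff hQ hm hδ hβ hj] at hcount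
      have hpos : 0 < 2 ^ Module.finrank (ZMod 2) β * (2 ^ (j + 1) - 1) := by
        have : 1 < 2 ^ (j + 1) := Nat.one_lt_two_pow (by omega)
        exact Nat.mul_pos (by positivity) (by omega)
      refine Nat.eq_of_mul_eq_mul_right hpos ?_
      rw [← hcount, Finset.prod_range_succ]
      ring
    · intro v hv
      simp only [Set.mem_toFinset, Set.mem_ofPred_eq] at hv
      obtain ⟨⟨hvβ, hv0⟩, hv⟩ := hv
      rw [← ih (hβ.sup_singleton hv0 hvβ) (by rw [finrank_sup_singleton hv]; omega),
        Set.ncard_eq_toFinset_card']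
      congr 1
      ext W
      simp only [Finset.bipartiteAbove, Finset.mem_filter, Set.mem_toFinset,
        mem_generatorsThrough, sup_le_iff, Submodule.span_singleton_le_iff_mem, and_assoc]
    · intro W hW
      simp only [Set.mem_toFinset] at hW
      obtain ⟨⟨hW, hWm⟩, hβW⟩ := hW
      have h1 : (Finset.bipartiteBelow (fun v W => v ∈ W)
          {v : V | (v ∈ perp Q β ∧ Q v = 0) ∧ v ∉ β}.toFinset W).card =
          ((W : Set V) \ β).ncard := by
        rw [Set.ncard_eq_toFinset_card']
        congr 1
        ext v
        simp only [Finset.bipartiteBelow, Finset.mem_filter, Set.mem_toFinset,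
          Set.mem_ofPred_eq, Set.mem_sdiff, SetLike.mem_coe]
        exact ⟨fun h => ⟨h.2, h.1.2⟩, fun h =>
          ⟨⟨⟨(hW.le_perp.trans (perp_anti hβW)) h.1, hW v h.1⟩, h.2⟩, h.1⟩⟩
      rw [h1, Set.ncard_sdiff (by exact_mod_cast hβW), ncard_submodule, ncard_submodule, hWm,
        ← hj, pow_add, Nat.mul_sub, mul_one]

end Count

/-! ### Points, types and adjacency in the switched graph -/

section Points

variable {Q : QuadraticForm (ZMod 2) V}

/-- The unique nonzero vector of a point of the quadric. -/
noncomputable def Point.vec (p : Point Q) : V := p.1.rep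

theorem Point.vec_ne_zero (p : Point Q) : p.vec ≠ 0 := p.1.rep_nonzero

theorem Point.submodule_eq (p : Point Q) :
    p.1.submodule = Submodule.span (ZMod 2) {p.vec} := p.1.submodule_eq

theorem Point.submodule_le_iff {p : Point Q} {W : Submodule (ZMod 2) V} :
    p.1.submodule ≤ W ↔ p.vec ∈ W := by
  rw [p.submodule_eq, Submodule.span_singleton_le_iff_mem]

theorem Point.map_vec (p : Point Q) : Q p.vec = 0 :=
  p.2 _ (Point.submodule_le_iff.1 le_rfl)

theorem Point.vec_injective : Function.Injective (Point.vec : Point Q → V) := by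
  intro p p' h
  apply Subtype.ext
  apply Projectivization.submodule_injective
  rw [p.submodule_eq, p'.submodule_eq, h]

theorem Point.exists_vec_eq {v : V} (h0 : v ≠ 0) (hv : Q v = 0) : ∃ p : Point Q, p.vec = v := by
  refine ⟨⟨Projectivization.mk (ZMod 2) v h0, ?_⟩, ?_⟩
  · rw [Projectivization.submodule_mk]
    exact contained_span_singleton hv
  · have h := Projectivization.submodule_mk (K := ZMod 2) v h0
    have h1 : (Projectivization.mk (ZMod 2) v h0).rep ∈ Submodule.span (ZMod 2) {v} := by
      rw [← h, Projectivization.submodule_eq]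
      exact Submodule.mem_span_singleton_self _
    exact (mem_span_singleton_iff.1 h1).resolve_left (Projectivization.rep_nonzero _)

theorem pointGraph_adj_iff {p p' : Point Q} :
    (pointGraph Q).Adj p p' ↔ p ≠ p' ∧ QuadraticMap.polar Q p.vec p'.vec = 0 := by
  refine and_congr_right fun _ => ⟨fun h => ?_, fun h => ?_⟩
  · exact h.polar_eq_zero (Point.submodule_le_iff.1 le_sup_left)
      (Point.submodule_le_iff.1 le_sup_right)
  · rw [p'.submodule_eq]
    refine Contained.sup_singleton p.2 p'.map_vec (mem_perp.2 fun w hw => ?_)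
    rw [p.submodule_eq, mem_span_singleton_iff] at hw
    rcases hw with rfl | rfl
    · simp
    · exact h

end Points

/-- The singular vectors orthogonal to `α` but outside it: the vectors of the points of
type (ii). -/
def tangentSet (Q : QuadraticForm (ZMod 2) V) (α : Submodule (ZMod 2) V) : Set V :=
  {v | (v ∈ perp Q α ∧ Q v = 0) ∧ v ∉ α}

section Types

variable {Q : QuadraticForm (ZMod 2) V} {α : Submodule (ZMod 2) V}

theorem mem_tangentSet {v : V} :
    v ∈ tangentSet Q α ↔ (v ∈ perp Q α ∧ Q v = 0) ∧ v ∉ α := Iff.rfl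

theorem add_mem_tangentSet (hα : Contained Q α) {v a : V} (hv : v ∈ tangentSet Q α)
    (ha : a ∈ α) : v + a ∈ tangentSet Q α := by
  obtain ⟨⟨hv, hv0⟩, hvα⟩ := hv
  refine ⟨⟨(perp Q α).add_mem hv (hα.le_perp ha), ?_⟩, fun h => hvα ?_⟩
  · rw [map_add_eq, hv0, hα a ha, mem_perp'.1 hv a ha]; rfl
  · exact (α.add_mem_iff_left ha).1 h

theorem add_add_self (v a : V) : v + a + a = v := by
  rw [add_assoc, add_self_eq_zero', add_zero]

theorem typeI_iff {p : Point Q} : TypeI α p ↔ p.vec ∈ α := Point.submodule_le_iff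

theorem typeII_iff [FiniteDimensional (ZMod 2) V] (hα : Contained Q α) {p : Point Q} :
    TypeII α p ↔ p.vec ∈ tangentSet Q α := by
  rw [TypeII, typeI_iff, mem_tangentSet, and_comm]
  refine and_congr_left fun hp => ⟨?_, fun h => ?_⟩
  · rintro ⟨W, hαW, hW, -, hpW⟩
    exact ⟨(hW.le_perp.trans (perp_anti hαW)) (Point.submodule_le_iff.1 hpW), p.map_vec⟩
  · refine ⟨α ⊔ Submodule.span (ZMod 2) {p.vec}, le_sup_left,
      hα.sup_singleton p.map_vec h.1, finrank_sup_singleton hp, ?_⟩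
    rw [p.submodule_eq]
    exact le_sup_right

theorem typeIII_iff [FiniteDimensional (ZMod 2) V] (hα : Contained Q α) {p : Point Q} :
    TypeIII α p ↔ p.vec ∉ perp Q α := by
  rw [TypeIII, typeI_iff, typeII_iff hα, mem_tangentSet]
  refine ⟨fun h h' => h.2 ⟨⟨h', p.map_vec⟩, h.1⟩, fun h => ⟨fun h' => h (hα.le_perp h'), ?_⟩⟩
  exact fun h' => h h'.1.1

theorem mem_cases {v : V} (hv : Q v = 0) :
    v ∈ α ∨ v ∈ tangentSet Q α ∨ v ∉ perp Q α := by
  rw [mem_tangentSet]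
  tauto

/-- Translation by a vector of `α` not orthogonal to `y` exchanges the vectors of type (ii)
orthogonal to `y` with the others, so there are equally many of each. -/
theorem two_mul_ncard_orthogonal [FiniteDimensional (ZMod 2) V] (hα : Contained Q α) {y : V}
    (hy : y ∉ perp Q α) :
    2 * {v | v ∈ tangentSet Q α ∧ QuadraticMap.polar Q y v = 0}.ncard =
      (tangentSet Q α).ncard := by
  have : Finite V := Module.finite_of_finite (ZMod 2)
  rw [mem_perp'] at hy
  push Not at hy
  obtain ⟨a, ha, hya⟩ := hy
  rw [zmod_two_ne_zero_iff] at hya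
  have h1 : tangentSet Q α \ {v | v ∈ tangentSet Q α ∧ QuadraticMap.polar Q y v = 0} =
      (· + a) '' {v | v ∈ tangentSet Q α ∧ QuadraticMap.polar Q y v = 0} := by
    ext v
    constructor
    · rintro ⟨hv, hv'⟩
      have h2 : QuadraticMap.polar Q y v = 1 := zmod_two_ne_zero_iff.1 fun h => hv' ⟨hv, h⟩
      refine ⟨v + a, ⟨add_mem_tangentSet hα hv ha, ?_⟩, add_add_self v a⟩
      rw [QuadraticMap.polar_add_right, h2, hya]; rfl
    · rintro ⟨w, ⟨hw, hw'⟩, rfl⟩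
      refine ⟨add_mem_tangentSet hα hw ha, fun h => ?_⟩
      have h2 := h.2
      rw [QuadraticMap.polar_add_right, hw', hya] at h2
      exact absurd h2 (by decide)
  have h2 := Set.ncard_sdiff_add_ncard_of_subset
    (show {v | v ∈ tangentSet Q α ∧ QuadraticMap.polar Q y v = 0} ⊆ tangentSet Q α from
      fun v hv => hv.1)
  rw [h1, Set.ncard_image_of_injective _ (add_left_injective a)] at h2
  omega

theorem isHalfAdjacent_iff [FiniteDimensional (ZMod 2) V] (hα : Contained Q α)
    (hne : (tangentSet Q α).Nonempty) {y : Point Q} :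
    IsHalfAdjacent (pointGraph Q) {p | TypeII α p} y ↔ y.vec ∉ perp Q α := by
  have hfin : Finite V := Module.finite_of_finite (ZMod 2)
  have hne0 : ∀ v ∈ tangentSet Q α, v ≠ 0 := by
    rintro v hv rfl
    exact hv.2 α.zero_mem
  have h1 : {p : Point Q | TypeII α p}.ncard = (tangentSet Q α).ncard := by
    rw [← Set.ncard_image_of_injective _ (Point.vec_injective (Q := Q))]
    congr 1
    ext v
    constructor
    · rintro ⟨p, hp, rfl⟩
      exact (typeII_iff hα).1 hp
    · intro hv
      obtain ⟨p, rfl⟩ := Point.exists_vec_eq (hne0 v hv) hv.1.2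
      exact ⟨p, (typeII_iff hα).2 hv, rfl⟩
  have h2 : ∀ y : Point Q, ¬ TypeII α y →
      {p | p ∈ {p : Point Q | TypeII α p} ∧ (pointGraph Q).Adj y p}.ncard =
      {v | v ∈ tangentSet Q α ∧ QuadraticMap.polar Q y.vec v = 0}.ncard := by
    intro y hy
    rw [← Set.ncard_image_of_injective _ (Point.vec_injective (Q := Q))]
    congr 1
    ext v
    constructor
    · rintro ⟨p, ⟨hp, hp'⟩, rfl⟩
      exact ⟨(typeII_iff hα).1 hp, (pointGraph_adj_iff.1 hp').2⟩
    · rintro ⟨hv, hv'⟩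
      obtain ⟨p, rfl⟩ := Point.exists_vec_eq (hne0 v hv) hv.1.2
      have hp : TypeII α p := (typeII_iff hα).2 hv
      refine ⟨p, ⟨hp, pointGraph_adj_iff.2 ⟨?_, hv'⟩⟩, rfl⟩
      rintro rfl
      exact hy hp
  constructor
  · rintro ⟨hy, hcard⟩ hperp
    have hy' : ¬ TypeII α y := hy
    have hyα : y.vec ∈ α := by
      by_contra h
      exact hy' ((typeII_iff hα).2 ⟨⟨hperp, y.map_vec⟩, h⟩)
    have h3 : {v | v ∈ tangentSet Q α ∧ QuadraticMap.polar Q y.vec v = 0} =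
        tangentSet Q α := by
      ext v
      exact ⟨fun h => h.1, fun h => ⟨h, h.1.1 _ hyα⟩⟩
    rw [h1, h2 y hy', h3] at hcard
    have h4 : (tangentSet Q α).ncard ≠ 0 := by
      exact ((Set.ncard_pos).2 hne).ne'
    omega
  · intro hy
    have hy' : ¬ TypeII α y := fun h => hy ((typeII_iff hα).1 h).1.1
    exact ⟨hy', by rw [h1, h2 y hy', two_mul_ncard_orthogonal hα hy]⟩

/-- Adjacency in the switched graph: the polar form must take the value `1` between vectors of
type (ii) and (iii), and `0` otherwise. -/
theorem switchedGraph_adj_iff [FiniteDimensional (ZMod 2) V] (hα : Contained Q α)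
    (hne : (tangentSet Q α).Nonempty) {p p' : Point Q} :
    (switchedGraph Q α).Adj p p' ↔ p ≠ p' ∧
      (((p.vec ∈ tangentSet Q α ∧ p'.vec ∉ perp Q α) ∨
          (p'.vec ∈ tangentSet Q α ∧ p.vec ∉ perp Q α)) ∧
        QuadraticMap.polar Q p.vec p'.vec = 1 ∨
      ¬ ((p.vec ∈ tangentSet Q α ∧ p'.vec ∉ perp Q α) ∨
          (p'.vec ∈ tangentSet Q α ∧ p.vec ∉ perp Q α)) ∧
        QuadraticMap.polar Q p.vec p'.vec = 0) := by
  have hII : ∀ q : Point Q, q ∈ {q : Point Q | TypeII α q} ↔ q.vec ∈ tangentSet Q α :=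
    fun q => typeII_iff hα
  have hsw : ((p ∈ {q : Point Q | TypeII α q} ∧
        IsHalfAdjacent (pointGraph Q) {q : Point Q | TypeII α q} p') ∨
      (p' ∈ {q : Point Q | TypeII α q} ∧
        IsHalfAdjacent (pointGraph Q) {q : Point Q | TypeII α q} p)) ↔
      ((p.vec ∈ tangentSet Q α ∧ p'.vec ∉ perp Q α) ∨
        (p'.vec ∈ tangentSet Q α ∧ p.vec ∉ perp Q α)) := by
    rw [isHalfAdjacent_iff hα hne, isHalfAdjacent_iff hα hne, hII, hII]
  have hne' : ((p.vec ∈ tangentSet Q α ∧ p'.vec ∉ perp Q α) ∨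
      (p'.vec ∈ tangentSet Q α ∧ p.vec ∉ perp Q α)) → p ≠ p' := by
    rintro (⟨h, h'⟩ | ⟨h, h'⟩) rfl
    · exact h' h.1.1
    · exact h' h.1.1
  change (_ ∧ ¬ (pointGraph Q).Adj p p') ∨ (¬ _ ∧ (pointGraph Q).Adj p p') ↔ _
  rw [hsw, pointGraph_adj_iff]
  by_cases h : (p.vec ∈ tangentSet Q α ∧ p'.vec ∉ perp Q α) ∨
      (p'.vec ∈ tangentSet Q α ∧ p.vec ∉ perp Q α)
  · simp only [h, hne' h, ne_eq, not_false_eq_true, true_and, not_true_eq_false, false_and,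
      or_false, zmod_two_ne_zero_iff.symm]
  · simp only [h, false_and, not_false_eq_true, true_and, false_or]

end Types

/-! ### Maximum cliques of the switched graph -/

/-- The set of nonzero vectors of a clique of the switched graph. -/
structure IsSwitchedClique (Q : QuadraticForm (ZMod 2) V) (α : Submodule (ZMod 2) V)
    (C : Set V) : Prop where
  ne_zero : ∀ v ∈ C, v ≠ 0
  singular : ∀ v ∈ C, Q v = 0
  polar_eq_one : ∀ v ∈ C, ∀ w ∈ C, v ∈ tangentSet Q α → w ∉ perp Q α →
    QuadraticMap.polar Q v w = 1
  polar_eq_zero_of_perp : ∀ v ∈ C, ∀ w ∈ C, v ∈ perp Q α → w ∈ perp Q α →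
    QuadraticMap.polar Q v w = 0
  polar_eq_zero_of_notMem : ∀ v ∈ C, ∀ w ∈ C, v ∉ tangentSet Q α → w ∉ tangentSet Q α →
    QuadraticMap.polar Q v w = 0

open Classical in
/-- Translate the vectors of type (ii) by `t` and fix the others. -/
noncomputable def shift (Q : QuadraticForm (ZMod 2) V) (α : Submodule (ZMod 2) V) (t v : V) : V :=
  if v ∈ tangentSet Q α then v + t else v

/-- The clique attached to a generator `W` that meets `α` in a hyperplane of `α`: its vectors of
type (i) and (iii) are those of `W`, and its vectors of type (ii) are those of `α ⊔ W` outside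
`W`. -/
def switchedGenerator (Q : QuadraticForm (ZMod 2) V) (α W : Submodule (ZMod 2) V) : Set V :=
  {v | v ≠ 0 ∧ ((v ∉ tangentSet Q α ∧ v ∈ W) ∨ (v ∈ tangentSet Q α ∧ v ∈ α ⊔ W ∧ v ∉ W))}

section Cliques

variable {Q : QuadraticForm (ZMod 2) V} {α : Submodule (ZMod 2) V}

theorem shift_of_mem {t v : V} (h : v ∈ tangentSet Q α) : shift Q α t v = v + t := if_pos h

theorem shift_of_notMem {t v : V} (h : v ∉ tangentSet Q α) : shift Q α t v = v := if_neg h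

theorem shift_mem_tangentSet (hα : Contained Q α) {t v : V} (ht : t ∈ α) :
    shift Q α t v ∈ tangentSet Q α ↔ v ∈ tangentSet Q α := by
  by_cases h : v ∈ tangentSet Q α
  · simp only [shift_of_mem h, h, add_mem_tangentSet hα h ht]
  · simp only [shift_of_notMem h]

theorem shift_shift (hα : Contained Q α) {t v : V} (ht : t ∈ α) :
    shift Q α t (shift Q α t v) = v := by
  by_cases h : v ∈ tangentSet Q α
  · rw [shift_of_mem ((shift_mem_tangentSet hα ht).2 h), shift_of_mem h, add_add_self]
  · rw [shift_of_notMem (fun h' => h ((shift_mem_tangentSet hα ht).1 h')), shift_of_notMem h]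

theorem shift_injective (hα : Contained Q α) {t : V} (ht : t ∈ α) :
    Function.Injective (shift Q α t) :=
  Function.LeftInverse.injective (g := shift Q α t) fun _ => shift_shift hα ht

theorem ne_zero_of_mem_tangentSet {v : V} (h : v ∈ tangentSet Q α) : v ≠ 0 := by
  rintro rfl
  exact h.2 α.zero_mem

theorem notMem_tangentSet_of_mem {v : V} (h : v ∈ α) : v ∉ tangentSet Q α :=
  fun h' => h'.2 h

theorem notMem_tangentSet_of_notMem_perp {v : V} (h : v ∉ perp Q α) : v ∉ tangentSet Q α :=
  fun h' => h h'.1.1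

theorem exists_notMem_of_finrank_inf_lt {W : Submodule (ZMod 2) V}
    (hd : Module.finrank (ZMod 2) ↥(α ⊓ W) < Module.finrank (ZMod 2) α) :
    ∃ a ∈ α, a ∉ W := by
  by_contra! h
  have : α ⊓ W = α := inf_eq_left.2 h
  rw [this] at hd
  exact lt_irrefl _ hd

theorem isSwitchedClique_diff_zero {W : Submodule (ZMod 2) V} (hW : Contained Q W)
    (h : α ≤ W) : IsSwitchedClique Q α ((W : Set V) \ {0}) where
  ne_zero _ hv := hv.2
  singular v hv := hW v hv.1
  polar_eq_one _ _ _ hw _ h2 :=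
    absurd ((hW.le_perp.trans (perp_anti h)) hw.1) h2
  polar_eq_zero_of_perp _ hv _ hw _ _ := hW.polar_eq_zero hv.1 hw.1
  polar_eq_zero_of_notMem _ hv _ hw _ _ := hW.polar_eq_zero hv.1 hw.1

theorem IsSwitchedClique.polar_eq_zero_of_mem (hα : Contained Q α) {C : Set V}
    (hC : IsSwitchedClique Q α C) {v w : V} (hv : v ∈ C) (hw : w ∈ C) (hvα : v ∈ α) :
    QuadraticMap.polar Q v w = 0 := by
  by_cases h : w ∈ tangentSet Q α
  · exact hC.polar_eq_zero_of_perp v hv w hw (hα.le_perp hvα) h.1.1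
  · exact hC.polar_eq_zero_of_notMem v hv w hw (notMem_tangentSet_of_mem hvα) h

/-- If all vectors of type (iii) of a clique of the switched graph induce the same functional
on `α`, then some shift turns the clique into a set of pairwise orthogonal vectors. -/
theorem IsSwitchedClique.contained_span_shift (hα : Contained Q α) {C : Set V}
    (hC : IsSwitchedClique Q α C) {t : V} (ht : t ∈ α)
    (h1 : ∀ y ∈ C, y ∉ perp Q α → QuadraticMap.polar Q t y = 1) :
    Contained Q (Submodule.span (ZMod 2) (shift Q α t '' C)) := by
  have hzero : ∀ w : V, w ∈ tangentSet Q α → QuadraticMap.polar Q t w = 0 :=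
    fun w hw => hw.1.1 t ht
  have hzero' : ∀ w : V, w ∈ tangentSet Q α → QuadraticMap.polar Q w t = 0 :=
    fun w hw => by rw [QuadraticMap.polar_comm]; exact hzero w hw
  have mixed : ∀ v ∈ C, ∀ w ∈ C, v ∈ tangentSet Q α → w ∉ tangentSet Q α →
      QuadraticMap.polar Q (v + t) w = 0 := by
    intro v hv w hw hvT hwT
    rw [QuadraticMap.polar_add_left]
    rcases mem_cases (α := α) (hC.singular w hw) with h | h | h
    · rw [hα.polar_eq_zero ht h, QuadraticMap.polar_comm,
        hC.polar_eq_zero_of_mem hα hw hv h, add_zero]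
    · exact absurd h hwT
    · rw [hC.polar_eq_one v hv w hw hvT h, h1 w hw h]; rfl
  refine contained_span ?_ ?_
  · rintro _ ⟨v, hv, rfl⟩
    by_cases h : v ∈ tangentSet Q α
    · exact ((shift_mem_tangentSet hα ht).2 h).1.2
    · rw [shift_of_notMem h]; exact hC.singular v hv
  · rintro _ ⟨v, hv, rfl⟩ _ ⟨w, hw, rfl⟩
    by_cases hvT : v ∈ tangentSet Q α <;> by_cases hwT : w ∈ tangentSet Q α
    · rw [shift_of_mem hvT, shift_of_mem hwT]
      simp only [QuadraticMap.polar_add_left, QuadraticMap.polar_add_right, hzero w hwT,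
        hzero' v hvT, polar_self_eq_zero, hC.polar_eq_zero_of_perp v hv w hw hvT.1.1 hwT.1.1,
        add_zero]
    · rw [shift_of_mem hvT, shift_of_notMem hwT]
      exact mixed v hv w hw hvT hwT
    · rw [shift_of_notMem hvT, shift_of_mem hwT, QuadraticMap.polar_comm]
      exact mixed w hw v hv hwT hvT
    · rw [shift_of_notMem hvT, shift_of_notMem hwT]
      exact hC.polar_eq_zero_of_notMem v hv w hw hvT hwT

/-- If two vectors of type (iii) of a clique of the switched graph induce different functionals
on `α`, then the clique injects into a subspace contained in the quadric, in such a way that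
no image is of type (ii). -/
theorem IsSwitchedClique.exists_injOn_of_add_notMem_perp (hα : Contained Q α) {C : Set V}
    (hC : IsSwitchedClique Q α C) {y₀ y₁ : V} (hy₀ : y₀ ∈ C) (hy₁ : y₁ ∈ C)
    (h0 : y₀ ∉ perp Q α) (h1 : y₁ ∉ perp Q α) (hz : y₁ + y₀ ∉ perp Q α) :
    ∃ (W : Submodule (ZMod 2) V) (f : V → V), Contained Q W ∧ Set.InjOn f C ∧
      Set.MapsTo f C ((W : Set V) \ {0}) ∧ ∀ v ∈ C, f v ∉ tangentSet Q α := by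
  by_cases hX : ∃ x ∈ C, x ∈ tangentSet Q α
  swap
  · push Not at hX
    refine ⟨Submodule.span (ZMod 2) C, id, ?_, Set.injOn_id _, ?_, hX⟩
    · exact contained_span hC.singular fun v hv w hw =>
        hC.polar_eq_zero_of_notMem v hv w hw (hX v hv) (hX w hw)
    · exact fun v hv => ⟨Submodule.subset_span hv, hC.ne_zero v hv⟩
  obtain ⟨x₀, hx₀, hx₀T⟩ := hX
  -- `S` consists of the differences of elements of equal type; it is orthogonal to all of `C`.
  set S : Set V := {v | (v ∈ C ∧ v ∈ α) ∨ (∃ x ∈ C, x ∈ tangentSet Q α ∧ x + x₀ = v) ∨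
    ∃ y ∈ C, y ∉ perp Q α ∧ y + y₀ = v} with hS
  have hSC : ∀ v ∈ S, ∀ w ∈ C, QuadraticMap.polar Q v w = 0 := by
    rintro v (⟨hv, hvα⟩ | ⟨x, hx, hxT, rfl⟩ | ⟨y, hy, hyT, rfl⟩) w hw
    · exact hC.polar_eq_zero_of_mem hα hv hw hvα
    · rw [QuadraticMap.polar_add_left]
      by_cases h : w ∈ perp Q α
      · rw [hC.polar_eq_zero_of_perp x hx w hw hxT.1.1 h,
          hC.polar_eq_zero_of_perp x₀ hx₀ w hw hx₀T.1.1 h, add_zero]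
      · rw [hC.polar_eq_one x hx w hw hxT h, hC.polar_eq_one x₀ hx₀ w hw hx₀T h]; rfl
    · rw [QuadraticMap.polar_add_left]
      by_cases h : w ∈ tangentSet Q α
      · rw [QuadraticMap.polar_comm, hC.polar_eq_one w hw y hy h hyT,
          QuadraticMap.polar_comm, hC.polar_eq_one w hw y₀ hy₀ h h0]; rfl
      · rw [hC.polar_eq_zero_of_notMem y hy w hw (notMem_tangentSet_of_notMem_perp hyT) h,
          hC.polar_eq_zero_of_notMem y₀ hy₀ w hw (notMem_tangentSet_of_notMem_perp h0) h,
          add_zero]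
  have hSS : ∀ v ∈ S, ∀ w ∈ S, QuadraticMap.polar Q v w = 0 := by
    rintro v hv w (⟨hw, -⟩ | ⟨x, hx, hxT, rfl⟩ | ⟨y, hy, hyT, rfl⟩)
    · exact hSC v hv w hw
    · rw [QuadraticMap.polar_add_right, hSC v hv x hx, hSC v hv x₀ hx₀, add_zero]
    · rw [QuadraticMap.polar_add_right, hSC v hv y hy, hSC v hv y₀ hy₀, add_zero]
  have hS0 : ∀ v ∈ S, Q v = 0 := by
    rintro v (⟨hv, -⟩ | ⟨x, hx, hxT, rfl⟩ | ⟨y, hy, hyT, rfl⟩)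
    · exact hC.singular v hv
    · rw [map_add_eq, hC.singular x hx, hC.singular x₀ hx₀,
        hC.polar_eq_zero_of_perp x hx x₀ hx₀ hxT.1.1 hx₀T.1.1]; rfl
    · rw [map_add_eq, hC.singular y hy, hC.singular y₀ hy₀,
        hC.polar_eq_zero_of_notMem y hy y₀ hy₀ (notMem_tangentSet_of_notMem_perp hyT)
          (notMem_tangentSet_of_notMem_perp h0)]; rfl
  set D := Submodule.span (ZMod 2) S with hD
  have hDc : Contained Q D := contained_span hS0 hSS
  have hDC : ∀ w ∈ C, w ∈ perp Q D := by
    intro w hw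
    have : D ≤ perp Q (Submodule.span (ZMod 2) {w}) := by
      rw [hD, Submodule.span_le]
      intro v hv
      refine mem_perp'.2 fun u hu => ?_
      rcases mem_span_singleton_iff.1 hu with rfl | rfl
      · simp
      · exact hSC v hv _ hw
    exact mem_perp.2 fun v hv =>
      mem_perp'.1 (this hv) w (Submodule.mem_span_singleton_self w)
  have hy₀D : y₀ ∉ D := by
    intro h
    have h2 := mem_perp'.1 (hDC x₀ hx₀) y₀ h
    rw [hC.polar_eq_one x₀ hx₀ y₀ hy₀ hx₀T h0] at h2
    exact absurd h2 (by decide)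
  have hαD : ∀ v ∈ C, v ∈ α → v ∈ D := fun v hv hvα => Submodule.subset_span (Or.inl ⟨hv, hvα⟩)
  have hXD : ∀ v ∈ C, v ∈ tangentSet Q α → v + x₀ ∈ D := fun v hv hvT =>
    Submodule.subset_span (Or.inr (Or.inl ⟨v, hv, hvT, rfl⟩))
  have hYD : ∀ v ∈ C, v ∉ perp Q α → v + y₀ ∈ D := fun v hv hvT =>
    Submodule.subset_span (Or.inr (Or.inr ⟨v, hv, hvT, rfl⟩))
  have hYD' : ∀ v ∈ C, v ∉ perp Q α → v ∉ D := fun v hv hvT h =>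
    hy₀D ((D.add_mem_iff_right h).1 (hYD v hv hvT))
  have hshift : ∀ v ∈ C, v ∈ tangentSet Q α →
      v + (x₀ + (y₁ + y₀)) ∈ D ∧ v + (x₀ + (y₁ + y₀)) ∉ perp Q α := by
    intro v hv hvT
    rw [← add_assoc]
    refine ⟨D.add_mem (hXD v hv hvT) (hYD y₁ hy₁ h1), fun h => hz ?_⟩
    exact ((perp Q α).add_mem_iff_right ((perp Q α).add_mem hvT.1.1 hx₀T.1.1)).1 h
  refine ⟨D ⊔ Submodule.span (ZMod 2) {y₀}, shift Q α (x₀ + (y₁ + y₀)),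
    hDc.sup_singleton (hC.singular y₀ hy₀) (hDC y₀ hy₀), ?_, ?_, ?_⟩
  · have key : ∀ v ∈ C, ∀ w ∈ C, v ∈ tangentSet Q α → w ∉ tangentSet Q α →
        v + (x₀ + (y₁ + y₀)) ≠ w := by
      rintro v hv w hw hvT hwT h
      obtain ⟨h2, h3⟩ := hshift v hv hvT
      rw [h] at h2 h3
      exact hYD' w hw h3 h2
    intro v hv w hw h
    by_cases hvT : v ∈ tangentSet Q α <;> by_cases hwT : w ∈ tangentSet Q α
    · rw [shift_of_mem hvT, shift_of_mem hwT] at h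
      exact add_right_cancel h
    · rw [shift_of_mem hvT, shift_of_notMem hwT] at h
      exact absurd h (key v hv w hw hvT hwT)
    · rw [shift_of_notMem hvT, shift_of_mem hwT] at h
      exact absurd h.symm (key w hw v hv hwT hvT)
    · rwa [shift_of_notMem hvT, shift_of_notMem hwT] at h
  · intro v hv
    rcases mem_cases (α := α) (hC.singular v hv) with h | h | h
    · rw [shift_of_notMem (notMem_tangentSet_of_mem h)]
      exact ⟨Submodule.mem_sup_left (hαD v hv h), hC.ne_zero v hv⟩
    · rw [shift_of_mem h]
      obtain ⟨h2, h3⟩ := hshift v hv h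
      refine ⟨Submodule.mem_sup_left h2, fun h4 => h3 ?_⟩
      rw [Set.mem_singleton_iff.1 h4]
      exact (perp Q α).zero_mem
    · rw [shift_of_notMem (notMem_tangentSet_of_notMem_perp h)]
      refine ⟨?_, hC.ne_zero v hv⟩
      rw [← add_add_self v y₀]
      exact Submodule.add_mem_sup (hYD v hv h) (Submodule.mem_span_singleton_self y₀)
  · intro v hv
    by_cases hvT : v ∈ tangentSet Q α
    · rw [shift_of_mem hvT]
      exact notMem_tangentSet_of_notMem_perp (hshift v hv hvT).2
    · rwa [shift_of_notMem hvT]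

section Finite

variable [FiniteDimensional (ZMod 2) V]

/-- Over `ZMod 2` a hyperplane has only one other coset. -/
theorem mem_or_add_mem_of_finrank {K U : Submodule (ZMod 2) V} (hKU : K ≤ U)
    (h : Module.finrank (ZMod 2) U ≤ Module.finrank (ZMod 2) K + 1) {a b : V} (ha : a ∈ U)
    (haK : a ∉ K) (hb : b ∈ U) : b ∈ K ∨ b + a ∈ K := by
  have h1 : K ⊔ Submodule.span (ZMod 2) {a} = U := by
    refine Submodule.eq_of_le_of_finrank_le (sup_le hKU ?_) ?_
    · rwa [Submodule.span_singleton_le_iff_mem]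
    · rwa [finrank_sup_singleton haK]
  rw [← h1] at hb
  obtain ⟨k, hk, c, hc, rfl⟩ := Submodule.mem_sup.1 hb
  rcases mem_span_singleton_iff.1 hc with rfl | rfl
  · left; simpa using hk
  · right; rwa [add_add_self]

theorem finrank_le_of_forall_add_mem {K U : Submodule (ZMod 2) V} {a : V}
    (h : ∀ b ∈ U, b ∈ K ∨ b + a ∈ K) :
    Module.finrank (ZMod 2) U ≤ Module.finrank (ZMod 2) K + 1 := by
  by_cases ha : a ∈ K
  · have : U ≤ K := fun b hb => (h b hb).elim id fun h' => (K.add_mem_iff_left ha).1 h'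
    exact (Submodule.finrank_mono this).trans (Nat.le_succ _)
  · rw [← finrank_sup_singleton ha]
    refine Submodule.finrank_mono fun b hb => ?_
    rcases h b hb with h' | h'
    · exact Submodule.mem_sup_left h'
    · rw [← add_add_self b a]
      exact Submodule.add_mem_sup h' (Submodule.mem_span_singleton_self a)

theorem mem_or_add_mem_of_mem_sup {W : Submodule (ZMod 2) V}
    (hd : Module.finrank (ZMod 2) α ≤ Module.finrank (ZMod 2) ↥(α ⊓ W) + 1) {a v : V}
    (ha : a ∈ α) (haW : a ∉ W) (hv : v ∈ α ⊔ W) : v ∈ W ∨ v + a ∈ W := by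
  obtain ⟨b, hb, w, hw, rfl⟩ := Submodule.mem_sup.1 hv
  rcases mem_or_add_mem_of_finrank inf_le_left hd ha (fun h => haW h.2) hb with h | h
  · exact Or.inl (W.add_mem h.2 hw)
  · right
    rw [add_right_comm]
    exact W.add_mem h.2 hw

theorem switchedGenerator_eq_image (hα : Contained Q α) {W : Submodule (ZMod 2) V}
    (hd : Module.finrank (ZMod 2) α ≤ Module.finrank (ZMod 2) ↥(α ⊓ W) + 1) {a : V}
    (ha : a ∈ α) (haW : a ∉ W) :
    switchedGenerator Q α W = shift Q α a '' ((W : Set V) \ {0}) := by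
  ext v
  constructor
  · rintro ⟨hv0, ⟨hv, hvW⟩ | ⟨hv, hvS, hvW⟩⟩
    · exact ⟨v, ⟨hvW, hv0⟩, shift_of_notMem hv⟩
    · have h1 := add_mem_tangentSet hα hv ha
      refine ⟨v + a, ⟨(mem_or_add_mem_of_mem_sup hd ha haW hvS).resolve_left hvW, ne_zero_of_mem_tangentSet h1⟩, ?_⟩
      rw [shift_of_mem h1, add_add_self]
  · rintro ⟨w, ⟨hw, hw0⟩, rfl⟩
    by_cases h : w ∈ tangentSet Q α
    · rw [shift_of_mem h]
      have h1 := add_mem_tangentSet hα h ha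
      refine ⟨ne_zero_of_mem_tangentSet h1, Or.inr ⟨h1, ?_, fun h2 => haW ?_⟩⟩
      · rw [add_comm]; exact Submodule.add_mem_sup ha hw
      · exact (W.add_mem_iff_right hw).1 h2
    · rw [shift_of_notMem h]
      exact ⟨hw0, Or.inl ⟨h, hw⟩⟩

theorem ncard_diff_zero (W : Submodule (ZMod 2) V) :
    ((W : Set V) \ {0}).ncard = 2 ^ Module.finrank (ZMod 2) W - 1 := by
  rw [Set.ncard_sdiff (by simp), ncard_submodule, Set.ncard_singleton]

theorem ncard_switchedGenerator (hα : Contained Q α) {W : Submodule (ZMod 2) V}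
    (hd : Module.finrank (ZMod 2) ↥(α ⊓ W) + 1 = Module.finrank (ZMod 2) α) :
    (switchedGenerator Q α W).ncard = 2 ^ Module.finrank (ZMod 2) W - 1 := by
  obtain ⟨a, ha, haW⟩ := exists_notMem_of_finrank_inf_lt (α := α) (W := W) (by omega)
  rw [switchedGenerator_eq_image hα hd.ge ha haW,
    Set.ncard_image_of_injective _ (shift_injective hα ha), ncard_diff_zero]

theorem isSwitchedClique_switchedGenerator (hα : Contained Q α) {W : Submodule (ZMod 2) V}
    (hW : Contained Q W)
    (hd : Module.finrank (ZMod 2) ↥(α ⊓ W) + 1 = Module.finrank (ZMod 2) α) :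
    IsSwitchedClique Q α (switchedGenerator Q α W) := by
  obtain ⟨a, ha, haW⟩ := exists_notMem_of_finrank_inf_lt (α := α) (W := W) (by omega)
  have haK : a ∉ α ⊓ W := fun h => haW h.2
  have hone : ∀ w ∈ W, w ∉ perp Q α → QuadraticMap.polar Q a w = 1 := by
    intro w hw hwα
    rw [← zmod_two_ne_zero_iff]
    refine fun h0 => hwα (mem_perp.2 fun b hb => ?_)
    rcases mem_or_add_mem_of_finrank inf_le_left hd.ge ha haK hb with h | h
    · exact hW.polar_eq_zero h.2 hw
    · have h1 := hW.polar_eq_zero h.2 hw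
      rwa [QuadraticMap.polar_add_left, h0, add_zero] at h1
  rw [switchedGenerator_eq_image hα hd.ge ha haW]
  have hzero : ∀ w : V, w ∈ tangentSet Q α → QuadraticMap.polar Q a w = 0 :=
    fun w hw => hw.1.1 a ha
  refine ⟨?_, ?_, ?_, ?_, ?_⟩
  · rintro _ ⟨v, hv, rfl⟩
    by_cases h : v ∈ tangentSet Q α
    · exact ne_zero_of_mem_tangentSet ((shift_mem_tangentSet hα ha).2 h)
    · rw [shift_of_notMem h]; exact hv.2
  · rintro _ ⟨v, hv, rfl⟩
    by_cases h : v ∈ tangentSet Q α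
    · exact ((shift_mem_tangentSet hα ha).2 h).1.2
    · rw [shift_of_notMem h]; exact hW v hv.1
  · rintro _ ⟨v, hv, rfl⟩ _ ⟨w, hw, rfl⟩ hv' hw'
    rw [shift_mem_tangentSet hα ha] at hv'
    have hwT : w ∉ tangentSet Q α := fun h =>
      hw' ((shift_mem_tangentSet hα ha).2 h).1.1
    rw [shift_of_notMem hwT] at hw' ⊢
    rw [shift_of_mem hv', QuadraticMap.polar_add_left, hW.polar_eq_zero hv.1 hw.1,
      hone w hw.1 hw', zero_add]
  · rintro _ ⟨v, hv, rfl⟩ _ ⟨w, hw, rfl⟩ hv' hw'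
    have key : ∀ u ∈ W, shift Q α a u ∈ perp Q α → shift Q α a u = u + a ∧ u ∈ tangentSet Q α ∨
        shift Q α a u = u ∧ u ∈ α := by
      intro u hu hu'
      by_cases h : u ∈ tangentSet Q α
      · exact Or.inl ⟨shift_of_mem h, h⟩
      · rw [shift_of_notMem h] at hu' ⊢
        refine Or.inr ⟨rfl, ?_⟩
        by_contra h'
        exact h ⟨⟨hu', hW u hu⟩, h'⟩
    have hvw := hW.polar_eq_zero hv.1 hw.1
    have haa : QuadraticMap.polar Q a a = 0 := polar_self_eq_zero a
    have hza : ∀ u : V, u ∈ tangentSet Q α → QuadraticMap.polar Q u a = 0 := fun u hu => by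
      rw [QuadraticMap.polar_comm]; exact hzero u hu
    rcases key v hv.1 hv' with ⟨e, hvT⟩ | ⟨e, hvT⟩ <;>
      rcases key w hw.1 hw' with ⟨e', hwT⟩ | ⟨e', hwT⟩
    · rw [e, e']
      simp only [QuadraticMap.polar_add_left, QuadraticMap.polar_add_right, hvw, haa,
        hzero w hwT, hza v hvT, add_zero]
    · rw [e, e', QuadraticMap.polar_add_left, hvw, hα.polar_eq_zero ha hwT, add_zero]
    · rw [e, e', QuadraticMap.polar_add_right, hvw, hα.polar_eq_zero hvT ha, add_zero]
    · rw [e, e', hvw]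
  · rintro _ ⟨v, hv, rfl⟩ _ ⟨w, hw, rfl⟩ hv' hw'
    rw [shift_mem_tangentSet hα ha] at hv' hw'
    rw [shift_of_notMem hv', shift_of_notMem hw']
    exact hW.polar_eq_zero hv.1 hw.1

/-- A generator always contains vectors of type (ii), as it meets `α^⊥` in a larger subspace than
`α`. -/
theorem exists_mem_tangentSet_of_generator (hQ : Nonsingular Q) (hα : Contained Q α)
    {W : Submodule (ZMod 2) V} (hW : Contained Q W)
    (hlt : Module.finrank (ZMod 2) α < Module.finrank (ZMod 2) W) :
    ∃ v ∈ W, v ∈ tangentSet Q α := by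
  by_contra! h
  have h1 : W ⊓ perp Q α ≤ α ⊓ W := by
    rintro v ⟨hv, hv'⟩
    refine ⟨?_, hv⟩
    by_contra h2
    exact h v hv ⟨⟨hv', hW v hv⟩, h2⟩
  have h2 := Submodule.finrank_mono h1
  have h3 := finrank_add_finrank_inf_le hQ hα hW
  omega

/-- A set that injects into the nonzero vectors of a subspace contained in the quadric has
fewer than `2 ^ m` elements; equality forces a bijection with the nonzero vectors of a
generator. -/
theorem HasWittIndex.ncard_le_of_injOn {m : ℕ} (hm : HasWittIndex Q m)
    {W : Submodule (ZMod 2) V} (hW : Contained Q W) {C : Set V} {f : V → V}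
    (hf : Set.InjOn f C) (hmaps : Set.MapsTo f C ((W : Set V) \ {0})) :
    C.ncard ≤ 2 ^ m - 1 ∧ (C.ncard = 2 ^ m - 1 →
      Module.finrank (ZMod 2) W = m ∧ f '' C = (W : Set V) \ {0}) := by
  have : Finite V := Module.finite_of_finite (ZMod 2)
  have h1 : C.ncard ≤ ((W : Set V) \ {0}).ncard := by
    rw [← hf.ncard_image]
    exact Set.ncard_le_ncard hmaps.image_subset
  have h2 := hm.finrank_le W hW
  have h3 : 2 ^ Module.finrank (ZMod 2) W ≤ 2 ^ m := Nat.pow_le_pow_right (by omega) h2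
  have h4 : 1 ≤ 2 ^ Module.finrank (ZMod 2) W := Nat.one_le_two_pow
  have h5 := ncard_diff_zero W
  refine ⟨by omega, fun h => ?_⟩
  have h6 : 2 ^ Module.finrank (ZMod 2) W = 2 ^ m := by omega
  refine ⟨Nat.pow_right_injective le_rfl h6, Set.eq_of_subset_of_ncard_le hmaps.image_subset ?_⟩
  rw [hf.ncard_image]
  omega

/-- The maximum cliques of the switched graph have `2 ^ m - 1` vertices and come from the
generators that contain `α` or meet it in a hyperplane. -/
theorem IsSwitchedClique.ncard_le (hQ : Nonsingular Q) {m : ℕ} (hm : HasWittIndex Q m)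
    (hα : Contained Q α) (hαm : Module.finrank (ZMod 2) α < m) {C : Set V}
    (hC : IsSwitchedClique Q α C) :
    C.ncard ≤ 2 ^ m - 1 ∧ (C.ncard = 2 ^ m - 1 →
      (∃ W ∈ generatorsThrough Q m α, C = (W : Set V) \ {0}) ∨
      ∃ W ∈ generatorsThrough Q m ⊥, Module.finrank (ZMod 2) ↥(α ⊓ W) + 1 =
        Module.finrank (ZMod 2) α ∧ C = switchedGenerator Q α W) := by
  by_cases h3 : ∃ y ∈ C, y ∉ perp Q α
  swap
  · push Not at h3
    have hCc : Contained Q (Submodule.span (ZMod 2) C) := contained_span hC.singular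
      fun v hv w hw => hC.polar_eq_zero_of_perp v hv w hw (h3 v hv) (h3 w hw)
    have hW : Contained Q (α ⊔ Submodule.span (ZMod 2) C) :=
      hα.sup hCc (Submodule.span_le.2 h3)
    obtain ⟨h4, h5⟩ := hm.ncard_le_of_injOn hW (Set.injOn_id C)
      fun v hv => ⟨Submodule.mem_sup_right (Submodule.subset_span hv), hC.ne_zero v hv⟩
    refine ⟨h4, fun h => Or.inl ⟨_, ⟨⟨hW, (h5 h).1⟩, le_sup_left⟩, ?_⟩⟩
    rw [← (h5 h).2, Set.image_id]
  obtain ⟨y₀, hy₀, h0⟩ := h3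
  by_cases hz : ∃ y₁ ∈ C, y₁ ∉ perp Q α ∧ y₁ + y₀ ∉ perp Q α
  · obtain ⟨y₁, hy₁, h1, hz⟩ := hz
    obtain ⟨W, f, hW, hf, hmaps, hnot⟩ :=
      hC.exists_injOn_of_add_notMem_perp hα hy₀ hy₁ h0 h1 hz
    obtain ⟨h4, h5⟩ := hm.ncard_le_of_injOn hW hf hmaps
    refine ⟨h4, fun h => ?_⟩
    obtain ⟨v, hvW, hvT⟩ := exists_mem_tangentSet_of_generator hQ hα hW (by rwa [(h5 h).1])
    have : v ∈ f '' C := by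
      rw [(h5 h).2]
      exact ⟨hvW, ne_zero_of_mem_tangentSet hvT⟩
    obtain ⟨c, hc, rfl⟩ := this
    exact absurd hvT (hnot c hc)
  · push Not at hz
    have ht : ∃ t ∈ α, QuadraticMap.polar Q t y₀ = 1 := by
      have := h0
      rw [mem_perp] at this
      push Not at this
      obtain ⟨t, ht, ht'⟩ := this
      exact ⟨t, ht, zmod_two_ne_zero_iff.1 ht'⟩
    obtain ⟨t, ht, ht'⟩ := ht
    have h1 : ∀ y ∈ C, y ∉ perp Q α → QuadraticMap.polar Q t y = 1 := by
      intro y hy hyα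
      have h2 := mem_perp.1 (hz y hy hyα) t ht
      rw [QuadraticMap.polar_add_right, ht'] at h2
      revert h2
      generalize QuadraticMap.polar Q t y = b
      revert b; decide
    have hW := hC.contained_span_shift hα ht h1
    set W := Submodule.span (ZMod 2) (shift Q α t '' C)
    have hmaps : Set.MapsTo (shift Q α t) C ((W : Set V) \ {0}) := by
      intro v hv
      refine ⟨Submodule.subset_span ⟨v, hv, rfl⟩, ?_⟩
      by_cases h : v ∈ tangentSet Q α
      · exact ne_zero_of_mem_tangentSet ((shift_mem_tangentSet hα ht).2 h)
      · rw [shift_of_notMem h]; exact hC.ne_zero v hv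
    obtain ⟨h4, h5⟩ := hm.ncard_le_of_injOn hW (shift_injective hα ht).injOn hmaps
    refine ⟨h4, fun h => Or.inr ?_⟩
    obtain ⟨hWm, himg⟩ := h5 h
    have hmemC : ∀ w ∈ W, w ∉ perp Q α → w ∈ C := by
      intro w hw hwα
      have : w ∈ shift Q α t '' C := by
        rw [himg]
        refine ⟨hw, fun h => hwα ?_⟩
        rw [Set.mem_singleton_iff.1 h]
        exact (perp Q α).zero_mem
      obtain ⟨c, hc, rfl⟩ := this
      have hcT : c ∉ tangentSet Q α := fun h =>
        hwα ((shift_mem_tangentSet hα ht).2 h).1.1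
      rwa [shift_of_notMem hcT]
    have hy₀W : y₀ ∈ W := by
      have := (hmaps hy₀).1
      rwa [shift_of_notMem (notMem_tangentSet_of_notMem_perp h0)] at this
    have htW : t ∉ W := by
      intro h
      have := hW.polar_eq_zero h hy₀W
      rw [ht'] at this
      exact absurd this (by decide)
    -- `W ⊓ α^⊥` is a hyperplane of `W`, and joining it to `α` gives a subspace of the quadric.
    have hd1 : Module.finrank (ZMod 2) W ≤ Module.finrank (ZMod 2) ↥(W ⊓ perp Q α) + 1 := by
      refine finrank_le_of_forall_add_mem (a := y₀) fun w hw => ?_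
      by_cases hwα : w ∈ perp Q α
      · exact Or.inl ⟨hw, hwα⟩
      · exact Or.inr ⟨W.add_mem hw hy₀W, hz w (hmemC w hw hwα) hwα⟩
    have hd2 := hm.finrank_le _ (hα.sup (hW.mono inf_le_left : Contained Q (W ⊓ perp Q α))
      inf_le_right)
    have hd3 := Submodule.finrank_sup_add_finrank_inf_eq α (W ⊓ perp Q α)
    have hd4 : Module.finrank (ZMod 2) ↥(α ⊓ (W ⊓ perp Q α)) ≤
        Module.finrank (ZMod 2) ↥(α ⊓ W) := Submodule.finrank_mono (inf_le_inf_left _ inf_le_left)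
    have hd5 : Module.finrank (ZMod 2) ↥(α ⊓ W) < Module.finrank (ZMod 2) α :=
      Submodule.finrank_lt_finrank_of_lt
        (lt_of_le_of_ne inf_le_left fun h => htW (inf_eq_left.1 h ht))
    have hd : Module.finrank (ZMod 2) ↥(α ⊓ W) + 1 = Module.finrank (ZMod 2) α := by omega
    refine ⟨W, ⟨⟨hW, hWm⟩, bot_le⟩, hd, ?_⟩
    rw [switchedGenerator_eq_image hα hd.ge ht htW, ← himg, Set.image_image]
    simp only [shift_shift hα ht, Set.image_id']

end Finite
end Cliques

/-! ### Maximum cliques and generators -/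

/-- The generators (subspaces of linear dimension `m` contained in the quadric) that meet `α` in
a hyperplane of `α`. -/
def hyperplaneGenerators (Q : QuadraticForm (ZMod 2) V) (m : ℕ) (α : Submodule (ZMod 2) V) :
    Set (Submodule (ZMod 2) V) :=
  {W | (Contained Q W ∧ Module.finrank (ZMod 2) W = m) ∧
    Module.finrank (ZMod 2) ↥(α ⊓ W) + 1 = Module.finrank (ZMod 2) α}

section Graph

variable {Q : QuadraticForm (ZMod 2) V} {α : Submodule (ZMod 2) V}

theorem ncard_image_vec (C : Finset (Point Q)) :
    (Point.vec '' (C : Set (Point Q))).ncard = C.card := by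
  rw [Set.ncard_image_of_injective _ Point.vec_injective, Set.ncard_coe_finset]

theorem mem_switchedGenerator_of_notMem_perp {W : Submodule (ZMod 2) V} {v : V}
    (hv : v ∉ perp Q α) : v ∈ switchedGenerator Q α W ↔ v ∈ W := by
  have h1 := notMem_tangentSet_of_notMem_perp hv
  have h2 : v ≠ 0 := by rintro rfl; exact hv (perp Q α).zero_mem
  simp only [switchedGenerator, Set.mem_ofPred_eq, h1, h2, ne_eq, not_false_eq_true, true_and,
    false_and, or_false]

theorem mem_switchedGenerator_of_mem {W : Submodule (ZMod 2) V} {v : V} (hv0 : v ≠ 0)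
    (hv : v ∈ α) : v ∈ switchedGenerator Q α W ↔ v ∈ W := by
  have h1 := notMem_tangentSet_of_mem (Q := Q) hv
  simp only [switchedGenerator, Set.mem_ofPred_eq, h1, hv0, ne_eq, not_false_eq_true, true_and,
    false_and, or_false]

theorem mem_switchedGenerator_of_mem_tangentSet {W : Submodule (ZMod 2) V} {v : V}
    (hv : v ∈ tangentSet Q α) : v ∈ switchedGenerator Q α W ↔ v ∈ α ⊔ W ∧ v ∉ W := by
  have h2 := ne_zero_of_mem_tangentSet hv
  simp only [switchedGenerator, Set.mem_ofPred_eq, hv, h2, ne_eq, not_false_eq_true, true_and,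
    not_true_eq_false, false_and, false_or]

section Finite

variable [FiniteDimensional (ZMod 2) V]

theorem isClique_switchedGraph_iff (hα : Contained Q α) (hne : (tangentSet Q α).Nonempty)
    {C : Set (Point Q)} :
    (switchedGraph Q α).IsClique C ↔ IsSwitchedClique Q α (Point.vec '' C) := by
  constructor
  · intro h
    refine ⟨?_, ?_, ?_, ?_, ?_⟩
    · rintro _ ⟨p, -, rfl⟩; exact p.vec_ne_zero
    · rintro _ ⟨p, -, rfl⟩; exact p.map_vec
    · rintro _ ⟨p, hp, rfl⟩ _ ⟨p', hp', rfl⟩ h1 h2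
      have hpp : p ≠ p' := by rintro rfl; exact h2 h1.1.1
      have h3 := ((switchedGraph_adj_iff hα hne).1 (h hp hp' hpp)).2
      rcases h3 with h3 | h3
      · exact h3.2
      · exact absurd (Or.inl ⟨h1, h2⟩) h3.1
    · rintro _ ⟨p, hp, rfl⟩ _ ⟨p', hp', rfl⟩ h1 h2
      by_cases hpp : p = p'
      · rw [hpp, polar_self_eq_zero]
      · have h3 := ((switchedGraph_adj_iff hα hne).1 (h hp hp' hpp)).2
        rcases h3 with ⟨h3 | h3, -⟩ | h3
        · exact absurd h2 h3.2
        · exact absurd h1 h3.2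
        · exact h3.2
    · rintro _ ⟨p, hp, rfl⟩ _ ⟨p', hp', rfl⟩ h1 h2
      by_cases hpp : p = p'
      · rw [hpp, polar_self_eq_zero]
      · have h3 := ((switchedGraph_adj_iff hα hne).1 (h hp hp' hpp)).2
        rcases h3 with ⟨h3 | h3, -⟩ | h3
        · exact absurd h3.1 h1
        · exact absurd h3.1 h2
        · exact h3.2
  · intro h p hp p' hp' hpp
    have hv : p.vec ∈ Point.vec '' C := ⟨p, hp, rfl⟩
    have hv' : p'.vec ∈ Point.vec '' C := ⟨p', hp', rfl⟩
    refine (switchedGraph_adj_iff hα hne).2 ⟨hpp, ?_⟩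
    by_cases h1 : (p.vec ∈ tangentSet Q α ∧ p'.vec ∉ perp Q α) ∨
        (p'.vec ∈ tangentSet Q α ∧ p.vec ∉ perp Q α)
    · refine Or.inl ⟨h1, ?_⟩
      rcases h1 with h1 | h1
      · exact h.polar_eq_one _ hv _ hv' h1.1 h1.2
      · rw [QuadraticMap.polar_comm]
        exact h.polar_eq_one _ hv' _ hv h1.1 h1.2
    · refine Or.inr ⟨h1, ?_⟩
      push Not at h1
      by_cases h2 : p.vec ∈ tangentSet Q α
      · exact h.polar_eq_zero_of_perp _ hv _ hv' h2.1.1 (h1.1 h2)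
      · by_cases h3 : p'.vec ∈ tangentSet Q α
        · exact h.polar_eq_zero_of_perp _ hv _ hv' (h1.2 h3) h3.1.1
        · exact h.polar_eq_zero_of_notMem _ hv _ hv' h2 h3

theorem exists_finset_image_vec_eq {S : Set V} (h0 : ∀ v ∈ S, v ≠ 0) (h1 : ∀ v ∈ S, Q v = 0) :
    ∃ C : Finset (Point Q), Point.vec '' (C : Set (Point Q)) = S := by
  refine ⟨(Set.toFinite {p : Point Q | p.vec ∈ S}).toFinset, ?_⟩
  rw [Set.Finite.coe_toFinset]
  ext v
  constructor
  · rintro ⟨p, hp, rfl⟩; exact hp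
  · intro hv
    obtain ⟨p, rfl⟩ := Point.exists_vec_eq (h0 v hv) (h1 v hv)
    exact ⟨p, hv, rfl⟩

theorem tangentSet_nonempty (hQ : Nonsingular Q) {m : ℕ} (hm : HasWittIndex Q m)
    (hα : Contained Q α) (hαm : Module.finrank (ZMod 2) α < m) :
    (tangentSet Q α).Nonempty := by
  obtain ⟨W, hW, hWm⟩ := hm.exists_contained
  obtain ⟨v, -, hv⟩ := exists_mem_tangentSet_of_generator hQ hα hW (by omega)
  exact ⟨v, hv⟩

theorem isMaximumClique_switchedGraph_iff (hQ : Nonsingular Q) {m : ℕ} (hm : HasWittIndex Q m)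
    (hα : Contained Q α) (hαm : Module.finrank (ZMod 2) α < m) {C : Finset (Point Q)} :
    (switchedGraph Q α).IsMaximumClique C ↔
      (∃ W ∈ generatorsThrough Q m α, (W : Set V) \ {0} = Point.vec '' (C : Set (Point Q))) ∨
      ∃ W ∈ hyperplaneGenerators Q m α,
        switchedGenerator Q α W = Point.vec '' (C : Set (Point Q)) := by
  have hne := tangentSet_nonempty hQ hm hα hαm
  have hle : ∀ D : Finset (Point Q), (switchedGraph Q α).IsClique D → D.card ≤ 2 ^ m - 1 := by
    intro D hD
    rw [← ncard_image_vec]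
    exact (((isClique_switchedGraph_iff hα hne).1 hD).ncard_le hQ hm hα hαm).1
  rw [SimpleGraph.isMaximumClique_iff]
  constructor
  · rintro ⟨hC, hmax⟩
    have hC' := (isClique_switchedGraph_iff hα hne).1 hC
    obtain ⟨W, ⟨hW, hWm⟩, hαW⟩ := exists_mem_generatorsThrough hQ hm hα
    obtain ⟨D, hD⟩ := exists_finset_image_vec_eq (Q := Q) (S := (W : Set V) \ {0})
      (fun v hv => hv.2) (fun v hv => hW v hv.1)
    have hDc : (switchedGraph Q α).IsClique D := by
      rw [isClique_switchedGraph_iff hα hne, hD]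
      exact isSwitchedClique_diff_zero hW hαW
    have h1 := hmax D hDc
    rw [← ncard_image_vec D, hD, ncard_diff_zero, hWm, ← ncard_image_vec C] at h1
    have h2 := hC'.ncard_le hQ hm hα hαm
    rcases h2.2 (le_antisymm h2.1 h1) with ⟨U, hU, h3⟩ | ⟨U, hU, h3, h4⟩
    · exact Or.inl ⟨U, hU, h3.symm⟩
    · exact Or.inr ⟨U, ⟨hU.1, h3⟩, h4.symm⟩
  · rintro (⟨W, ⟨⟨hW, hWm⟩, hαW⟩, h⟩ | ⟨W, ⟨⟨hW, hWm⟩, hd⟩, h⟩)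
    · refine ⟨(isClique_switchedGraph_iff hα hne).2 (h ▸ isSwitchedClique_diff_zero hW hαW),
        fun D hD => (hle D hD).trans ?_⟩
      rw [← ncard_image_vec C, ← h, ncard_diff_zero, hWm]
    · refine ⟨(isClique_switchedGraph_iff hα hne).2
        (h ▸ isSwitchedClique_switchedGenerator hα hW hd), fun D hD => (hle D hD).trans ?_⟩
      rw [← ncard_image_vec C, ← h, ncard_switchedGenerator hα hd, hWm]

/-- A generator that meets `α` in a hyperplane contains vectors of type (iii). -/
theorem exists_notMem_perp_of_mem_hyperplaneGenerators {m : ℕ} (hm : HasWittIndex Q m)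
    (hα : Contained Q α) {W : Submodule (ZMod 2) V} (hW : W ∈ hyperplaneGenerators Q m α) :
    ∃ y ∈ W, y ∉ perp Q α := by
  obtain ⟨⟨hW, hWm⟩, hd⟩ := hW
  obtain ⟨a, ha, haW⟩ := exists_notMem_of_finrank_inf_lt (α := α) (W := W) (by omega)
  by_contra! h
  exact haW (hm.mem_of_mem_perp hW hWm (hα a ha) fun w hw => mem_perp'.1 (h w hw) a ha)

/-- A generator in `hyperplaneGenerators` is spanned by the vectors of type (iii) of its clique. -/
theorem switchedGenerator_injOn {m : ℕ} (hm : HasWittIndex Q m) (hα : Contained Q α) :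
    Set.InjOn (switchedGenerator Q α) (hyperplaneGenerators Q m α) := by
  have key : ∀ W ∈ hyperplaneGenerators Q m α, ∀ U : Submodule (ZMod 2) V,
      switchedGenerator Q α W = switchedGenerator Q α U → W ≤ U := by
    intro W hW U h
    have h1 : ∀ w ∈ W, w ∉ perp Q α → w ∈ U := by
      intro w hw hwα
      rwa [← mem_switchedGenerator_of_notMem_perp hwα, h,
        mem_switchedGenerator_of_notMem_perp hwα] at hw
    obtain ⟨y, hy, hyα⟩ := exists_notMem_perp_of_mem_hyperplaneGenerators hm hα hW
    intro w hw
    by_cases hwα : w ∈ perp Q α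
    · rw [← add_add_self w y]
      refine U.add_mem (h1 _ (W.add_mem hw hy) fun h2 => hyα ?_) (h1 y hy hyα)
      exact ((perp Q α).add_mem_iff_right hwα).1 h2
    · exact h1 w hw hwα
  intro W hW U hU h
  exact le_antisymm (key W hW U h) (key U hU W h.symm)

/-- The cliques of maximum size through a vertex are counted by two families of generators. -/
theorem numMaxCliquesThrough_eq (hQ : Nonsingular Q) {m : ℕ} (hm : HasWittIndex Q m)
    (hα : Contained Q α) (hαm : Module.finrank (ZMod 2) α < m) (x : Point Q) :
    numMaxCliquesThrough Q α x =
      {W | W ∈ generatorsThrough Q m α ∧ x.vec ∈ W}.ncard +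
      {W | W ∈ hyperplaneGenerators Q m α ∧ x.vec ∈ switchedGenerator Q α W}.ncard := by
  have hfin : Finite V := Module.finite_of_finite (ZMod 2)
  set f : Submodule (ZMod 2) V → Set V := fun W => (W : Set V) \ {0} with hf
  have hfinj : Function.Injective f := by
    intro W U h
    ext v
    by_cases h0 : v = 0
    · simp [h0]
    · have := Set.ext_iff.1 h v
      simpa [hf, h0] using this
  set A := {W | W ∈ generatorsThrough Q m α ∧ x.vec ∈ W}
  set B := {W | W ∈ hyperplaneGenerators Q m α ∧ x.vec ∈ switchedGenerator Q α W}
  have hinjB : Set.InjOn (switchedGenerator Q α) B :=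
    (switchedGenerator_injOn hm hα).mono fun W hW => hW.1
  rw [← Set.ncard_image_of_injective A hfinj, ← hinjB.ncard_image,
    ← Set.ncard_union_eq]
  · have hvinj : Function.Injective
        (fun C : Finset (Point Q) => Point.vec '' (C : Set (Point Q))) := by
      intro C D h
      exact Finset.coe_injective (Set.image_injective.2 Point.vec_injective h)
    rw [numMaxCliquesThrough, ← Set.ncard_image_of_injective _ hvinj]
    congr 1
    ext S
    constructor
    · rintro ⟨C, ⟨hC, hx⟩, rfl⟩
      have hx' : x.vec ∈ Point.vec '' (C : Set (Point Q)) := ⟨x, hx, rfl⟩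
      rcases (isMaximumClique_switchedGraph_iff hQ hm hα hαm).1 hC with
        ⟨W, hW, h⟩ | ⟨W, hW, h⟩
      · exact Or.inl ⟨W, ⟨hW, (h ▸ hx' : x.vec ∈ (W : Set V) \ {0}).1⟩, h⟩
      · exact Or.inr ⟨W, ⟨hW, h ▸ hx'⟩, h⟩
    · have hmem : ∀ C : Finset (Point Q), x.vec ∈ Point.vec '' (C : Set (Point Q)) → x ∈ C := by
        rintro C ⟨p, hp, h⟩
        rwa [← Point.vec_injective h]
      rintro (⟨W, ⟨hW, hx⟩, rfl⟩ | ⟨W, ⟨hW, hx⟩, rfl⟩)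
      · obtain ⟨C, hC⟩ := exists_finset_image_vec_eq (Q := Q) (S := f W)
          (fun v hv => hv.2) (fun v hv => hW.1.1 v hv.1)
        refine ⟨C, ⟨?_, hmem C ?_⟩, hC⟩
        · exact (isMaximumClique_switchedGraph_iff hQ hm hα hαm).2 (Or.inl ⟨W, hW, hC.symm⟩)
        · rw [hC]; exact ⟨hx, x.vec_ne_zero⟩
      · have hcl := isSwitchedClique_switchedGenerator hα hW.1.1 hW.2
        obtain ⟨C, hC⟩ := exists_finset_image_vec_eq hcl.ne_zero hcl.singular
        refine ⟨C, ⟨?_, hmem C (hC ▸ hx)⟩, hC⟩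
        exact (isMaximumClique_switchedGraph_iff hQ hm hα hαm).2 (Or.inr ⟨W, hW, hC.symm⟩)
  · -- Cliques of the first family lie in `α^⊥`, those of the second do not.
    rw [Set.disjoint_left]
    rintro _ ⟨W, ⟨⟨⟨hW, -⟩, hαW⟩, -⟩, rfl⟩ ⟨U, ⟨hU, -⟩, h⟩
    obtain ⟨y, hy, hyα⟩ := exists_notMem_perp_of_mem_hyperplaneGenerators hm hα hU
    rw [← mem_switchedGenerator_of_notMem_perp hyα, h] at hy
    exact hyα ((hW.le_perp.trans (perp_anti hαW)) hy.1)

end Finite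
end Graph

/-! ### Counting the generators attached to a vertex -/

theorem ncard_eq_mul_of_fibers {A B : Type*} [Finite A] [Finite B] {s : Set A} {t : Set B}
    {f : A → B} (hf : Set.MapsTo f s t) {n : ℕ} (h : ∀ b ∈ t, {a | a ∈ s ∧ f a = b}.ncard = n) :
    s.ncard = t.ncard * n := by
  classical
  have := Fintype.ofFinite A
  have := Fintype.ofFinite B
  rw [Set.ncard_eq_toFinset_card' s, Set.ncard_eq_toFinset_card' t,
    Finset.card_eq_sum_card_fiberwise (f := f) (t := t.toFinset)
      (by simpa using hf), Finset.sum_const_nat]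
  intro b hb
  rw [← h b (Set.mem_toFinset.1 hb), Set.ncard_eq_toFinset_card']
  congr 1
  ext a
  simp

/-- The hyperplanes of `α` that contain `L`. -/
def hyperplanesThrough (L α : Submodule (ZMod 2) V) : Set (Submodule (ZMod 2) V) :=
  {K | (L ≤ K ∧ K ≤ α) ∧ Module.finrank (ZMod 2) K + 1 = Module.finrank (ZMod 2) α}

section Count

variable {Q : QuadraticForm (ZMod 2) V} {α : Submodule (ZMod 2) V}

theorem mem_perp_span_singleton {v w : V} :
    w ∈ perp Q (Submodule.span (ZMod 2) {v}) ↔ QuadraticMap.polar Q v w = 0 := by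
  rw [mem_perp]
  constructor
  · exact fun h => h v (Submodule.mem_span_singleton_self v)
  · intro h u hu
    rcases mem_span_singleton_iff.1 hu with rfl | rfl
    · simp
    · exact h

theorem generatorsThrough_and_mem {m : ℕ} {β : Submodule (ZMod 2) V} {v : V} :
    {W | W ∈ generatorsThrough Q m β ∧ v ∈ W} =
      generatorsThrough Q m (β ⊔ Submodule.span (ZMod 2) {v}) := by
  ext W
  simp only [Set.mem_ofPred_eq, mem_generatorsThrough, sup_le_iff,
    Submodule.span_singleton_le_iff_mem, and_assoc]

theorem inf_mem_hyperplanesThrough_bot {m : ℕ} {W : Submodule (ZMod 2) V}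
    (hW : W ∈ hyperplaneGenerators Q m α) : α ⊓ W ∈ hyperplanesThrough ⊥ α :=
  ⟨⟨bot_le, inf_le_left⟩, hW.2⟩

theorem not_le_of_mem_hyperplaneGenerators {m : ℕ} {W : Submodule (ZMod 2) V}
    (hW : W ∈ hyperplaneGenerators Q m α) : ¬ α ≤ W := by
  intro h
  have h1 := hW.2
  rw [inf_eq_left.2 h] at h1
  omega

theorem HasProjectiveIndex.hasWittIndex {g : ℕ} (h : HasProjectiveIndex Q (g : ℤ)) :
    HasWittIndex Q (g + 1) where
  exists_contained := by
    obtain ⟨W, hW, hd⟩ := h.1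
    exact ⟨W, hW, by omega⟩
  finrank_le W hW := by
    have := h.2 (show ((Module.finrank (ZMod 2) W : ℤ) - 1) ∈ _ from ⟨W, hW, by ring⟩)
    omega

theorem prod_Icc_eq_prod_range {a n j : ℕ} (h : n + 1 = a + j) :
    ∏ i ∈ Finset.Icc a n, (2 ^ i + 1 : ℤ) = ∏ i ∈ Finset.range j, (2 ^ (a + i) + 1 : ℤ) := by
  have h1 : Finset.Icc a n = Finset.Ico a (a + j) := by
    ext i
    simp only [Finset.mem_Icc, Finset.mem_Ico]
    omega
  rw [h1, Finset.prod_Ico_eq_prod_range, Nat.add_sub_cancel_left]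

section Finite

variable [FiniteDimensional (ZMod 2) V]

theorem finrank_inf_perp_singleton {y : V} (hy : y ∉ perp Q α) :
    Module.finrank (ZMod 2) ↥(α ⊓ perp Q (Submodule.span (ZMod 2) {y})) + 1 =
      Module.finrank (ZMod 2) α := by
  rw [mem_perp'] at hy
  push Not at hy
  obtain ⟨t, ht, hty⟩ := hy
  refine le_antisymm (Submodule.finrank_lt_finrank_of_lt
    (lt_of_le_of_ne inf_le_left fun h => ?_)) ?_
  · exact hty (mem_perp_span_singleton.1 (inf_eq_left.1 h ht))
  · refine finrank_le_of_forall_add_mem (a := t) fun b hb => ?_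
    by_cases h : QuadraticMap.polar Q y b = 0
    · exact Or.inl ⟨hb, mem_perp_span_singleton.2 h⟩
    · refine Or.inr ⟨α.add_mem hb ht, mem_perp_span_singleton.2 ?_⟩
      rw [QuadraticMap.polar_add_right, zmod_two_ne_zero_iff.1 h, zmod_two_ne_zero_iff.1 hty]
      rfl

/-- The hyperplanes of `α` are the subspaces `α ⊓ y^⊥` with `y ∉ α^⊥`, and each arises from equally
many `y`. -/
theorem ncard_hyperplanesThrough (hQ : Nonsingular Q) (hα : Contained Q α)
    {L : Submodule (ZMod 2) V} (hL : L ≤ α) :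
    (hyperplanesThrough L α).ncard =
      2 ^ (Module.finrank (ZMod 2) α - Module.finrank (ZMod 2) L) - 1 := by
  have hfin : Finite V := Module.finite_of_finite (ZMod 2)
  have hcard : ∀ K : Submodule (ZMod 2) V, K ≤ α → ((perp Q K : Set V) \ perp Q α).ncard =
      (2 ^ (Module.finrank (ZMod 2) α - Module.finrank (ZMod 2) K) - 1) *
        2 ^ Module.finrank (ZMod 2) (perp Q α) := by
    intro K hK
    have h1 := finrank_add_finrank_perp hQ hα
    have h2 := finrank_add_finrank_perp hQ (hα.mono hK)
    have h3 := Submodule.finrank_mono hK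
    rw [Set.ncard_sdiff (by exact_mod_cast perp_anti hK), ncard_submodule, ncard_submodule,
      Nat.sub_mul, ← pow_add, one_mul]
    congr 2
    omega
  have h := ncard_eq_mul_of_fibers (s := (perp Q L : Set V) \ perp Q α)
    (t := hyperplanesThrough L α) (f := fun y => α ⊓ perp Q (Submodule.span (ZMod 2) {y}))
    (n := 2 ^ Module.finrank (ZMod 2) (perp Q α)) ?_ ?_
  · rw [hcard L hL] at h
    exact (Nat.eq_of_mul_eq_mul_right (by positivity) h).symm
  · rintro y ⟨hyL, hyα⟩
    refine ⟨⟨le_inf hL fun v hv => ?_, inf_le_left⟩, finrank_inf_perp_singleton hyα⟩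
    exact mem_perp_span_singleton.2 (mem_perp'.1 hyL v hv)
  · rintro K ⟨⟨hLK, hKα⟩, hK⟩
    have h1 : {y | y ∈ (perp Q L : Set V) \ perp Q α ∧
        α ⊓ perp Q (Submodule.span (ZMod 2) {y}) = K} = (perp Q K : Set V) \ perp Q α := by
      ext y
      constructor
      · rintro ⟨⟨hyL, hyα⟩, rfl⟩
        exact ⟨mem_perp'.2 fun k hk => mem_perp_span_singleton.1 hk.2, hyα⟩
      · rintro ⟨hyK, hyα⟩
        refine ⟨⟨perp_anti hLK hyK, hyα⟩, ?_⟩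
        have h2 := finrank_inf_perp_singleton hyα
        refine (Submodule.eq_of_le_of_finrank_eq (le_inf hKα fun v hv => ?_) (by omega)).symm
        exact mem_perp_span_singleton.2 (mem_perp'.1 hyK v hv)
    rw [h1, hcard K hKα, show Module.finrank (ZMod 2) α - Module.finrank (ZMod 2) K = 1 by omega]
    simp

theorem ncard_generatorsThrough_not_le (hQ : Nonsingular Q) {m δ : ℕ} (hm : HasWittIndex Q m)
    (hδ : Module.finrank (ZMod 2) V = 2 * m + δ) {β γ : Submodule (ZMod 2) V}
    (hγ : Contained Q γ) (hβγ : β ≤ γ) {j : ℕ}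
    (hγj : Module.finrank (ZMod 2) γ + j = m) (hβj : Module.finrank (ZMod 2) β + (j + 1) = m) :
    {W | W ∈ generatorsThrough Q m β ∧ ¬ γ ≤ W}.ncard =
      2 ^ (δ + j) * ∏ i ∈ Finset.range j, (2 ^ (δ + i) + 1) := by
  have hfin : Finite V := Module.finite_of_finite (ZMod 2)
  have h1 : {W | W ∈ generatorsThrough Q m β ∧ ¬ γ ≤ W} =
      generatorsThrough Q m β \ generatorsThrough Q m γ := by
    ext W
    exact ⟨fun h => ⟨h.1, fun h' => h.2 h'.2⟩, fun h => ⟨h.1, fun h' => h.2 ⟨h.1.1, h'⟩⟩⟩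
  have h2 : generatorsThrough Q m γ ⊆ generatorsThrough Q m β :=
    fun W hW => ⟨hW.1, hβγ.trans hW.2⟩
  rw [h1, Set.ncard_sdiff h2, ncard_generatorsThrough hQ hm hδ (hγ.mono hβγ) hβj,
    ncard_generatorsThrough hQ hm hδ hγ hγj, Finset.prod_range_succ, mul_add, mul_one,
    Nat.add_sub_cancel, mul_comm]

theorem inf_eq_of_mem_hyperplanesThrough {L K W : Submodule (ZMod 2) V}
    (hK : K ∈ hyperplanesThrough L α) (hKW : K ≤ W) (hαW : ¬ α ≤ W) : α ⊓ W = K := by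
  refine (Submodule.eq_of_le_of_finrank_le (le_inf hK.1.2 hKW) ?_).symm
  have h1 : Module.finrank (ZMod 2) ↥(α ⊓ W) < Module.finrank (ZMod 2) α :=
    Submodule.finrank_lt_finrank_of_lt
      (lt_of_le_of_ne inf_le_left fun h => hαW (inf_eq_left.1 h))
  have h2 := hK.2
  omega

/-- For `v` of type (i): choose the hyperplane of `α` first, then a generator through it that
does not contain `α`. -/
theorem ncard_hyperplaneGenerators_of_mem (hQ : Nonsingular Q) {m δ : ℕ} (hm : HasWittIndex Q m)
    (hδ : Module.finrank (ZMod 2) V = 2 * m + δ) (hα : Contained Q α) {j : ℕ}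
    (hj : Module.finrank (ZMod 2) α + j = m) {v : V} (hv0 : v ≠ 0) (hv : v ∈ α) :
    {W | W ∈ hyperplaneGenerators Q m α ∧ v ∈ switchedGenerator Q α W}.ncard =
      (2 ^ (Module.finrank (ZMod 2) α - 1) - 1) *
        (2 ^ (δ + j) * ∏ i ∈ Finset.range j, (2 ^ (δ + i) + 1)) := by
  have hfin : Finite V := Module.finite_of_finite (ZMod 2)
  simp only [mem_switchedGenerator_of_mem hv0 hv]
  have hspan : Submodule.span (ZMod 2) {v} ≤ α := by rwa [Submodule.span_singleton_le_iff_mem]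
  have h1 := ncard_hyperplanesThrough hQ hα hspan
  rw [finrank_span_singleton hv0] at h1
  rw [← h1]
  refine ncard_eq_mul_of_fibers (f := fun W => α ⊓ W) ?_ ?_
  · rintro W ⟨hW, hvW⟩
    refine ⟨⟨?_, inf_le_left⟩, hW.2⟩
    rw [Submodule.span_singleton_le_iff_mem]
    exact ⟨hv, hvW⟩
  · intro K hK
    have hKd := hK.2
    rw [← ncard_generatorsThrough_not_le hQ hm hδ hα hK.1.2 hj (by omega)]
    congr 1
    ext W
    constructor
    · rintro ⟨⟨hW, hvW⟩, rfl⟩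
      exact ⟨⟨hW.1, inf_le_right⟩, not_le_of_mem_hyperplaneGenerators hW⟩
    · rintro ⟨⟨hW, hKW⟩, hαW⟩
      have h2 := inf_eq_of_mem_hyperplanesThrough hK hKW hαW
      refine ⟨⟨⟨hW, by rw [h2]; exact hKd⟩, hKW (hK.1.1 ?_)⟩, h2⟩
      exact Submodule.mem_span_singleton_self v

/-- For `v` of type (ii): a hyperplane `K` of `α` and `b ∈ α \ K` being given, the generators
wanted are those through `K` and `v + b` that do not contain `α` and `v`. -/
theorem ncard_hyperplaneGenerators_of_mem_tangentSet (hQ : Nonsingular Q) {m δ : ℕ}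
    (hm : HasWittIndex Q m) (hδ : Module.finrank (ZMod 2) V = 2 * m + δ) (hα : Contained Q α)
    {j : ℕ} (hj : Module.finrank (ZMod 2) α + (j + 1) = m) {v : V} (hv : v ∈ tangentSet Q α) :
    {W | W ∈ hyperplaneGenerators Q m α ∧ v ∈ switchedGenerator Q α W}.ncard =
      (2 ^ Module.finrank (ZMod 2) α - 1) *
        (2 ^ (δ + j) * ∏ i ∈ Finset.range j, (2 ^ (δ + i) + 1)) := by
  have hfin : Finite V := Module.finite_of_finite (ZMod 2)
  simp only [mem_switchedGenerator_of_mem_tangentSet hv]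
  have h1 := ncard_hyperplanesThrough hQ hα (bot_le : ⊥ ≤ α)
  rw [finrank_bot, Nat.sub_zero] at h1
  rw [← h1]
  refine ncard_eq_mul_of_fibers (f := fun W => α ⊓ W)
    (fun W hW => inf_mem_hyperplanesThrough_bot hW.1) ?_
  intro K hK
  have hKd := hK.2
  obtain ⟨b, hb, hbK⟩ : ∃ b ∈ α, b ∉ K := by
    by_contra! h
    have := Submodule.finrank_mono (show α ≤ K from h)
    omega
  have hvb := add_mem_tangentSet hα hv hb
  have hd1 := finrank_sup_singleton hv.2
  have hd2 := finrank_sup_singleton (U := K) (v := v + b) (fun h => hvb.2 (hK.1.2 h))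
  have hγ : Contained Q (α ⊔ Submodule.span (ZMod 2) {v}) := hα.sup_singleton hv.1.2 hv.1.1
  have hle : K ⊔ Submodule.span (ZMod 2) {v + b} ≤ α ⊔ Submodule.span (ZMod 2) {v} := by
    refine sup_le (hK.1.2.trans le_sup_left) ?_
    rw [Submodule.span_singleton_le_iff_mem, add_comm]
    exact Submodule.add_mem_sup hb (Submodule.mem_span_singleton_self v)
  rw [← ncard_generatorsThrough_not_le hQ hm hδ hγ hle (j := j) (by omega) (by omega)]
  congr 1
  ext W
  constructor
  · rintro ⟨⟨hW, hvS, hvW⟩, rfl⟩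
    refine ⟨⟨hW.1, sup_le inf_le_right ?_⟩, fun h => hvW (h (Submodule.mem_sup_right
      (Submodule.mem_span_singleton_self v)))⟩
    rw [Submodule.span_singleton_le_iff_mem]
    exact (mem_or_add_mem_of_mem_sup hW.2.ge hb (fun h => hbK ⟨hb, h⟩) hvS).resolve_left hvW
  · rintro ⟨⟨hW, hKW⟩, hnot⟩
    have hvbW : v + b ∈ W :=
      hKW (Submodule.mem_sup_right (Submodule.mem_span_singleton_self _))
    have hαW : ¬ α ≤ W := by
      intro h
      refine hnot (sup_le h ?_)
      rw [Submodule.span_singleton_le_iff_mem]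
      exact (W.add_mem_iff_left (h hb)).1 hvbW
    have h2 := inf_eq_of_mem_hyperplanesThrough hK (le_sup_left.trans hKW) hαW
    refine ⟨⟨⟨hW, by rw [h2]; exact hKd⟩, ?_, fun h => hbK ?_⟩, h2⟩
    · rw [← add_add_self v b, add_comm]
      exact Submodule.add_mem_sup hb hvbW
    · rw [← h2]
      exact ⟨hb, (W.add_mem_iff_right h).1 hvbW⟩

/-- For `v` of type (iii): the hyperplane of `α` has to be `α ⊓ v^⊥`. -/
theorem ncard_hyperplaneGenerators_of_notMem_perp (hQ : Nonsingular Q) {m δ : ℕ}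
    (hm : HasWittIndex Q m) (hδ : Module.finrank (ZMod 2) V = 2 * m + δ) (hα : Contained Q α)
    {j : ℕ} (hj : Module.finrank (ZMod 2) α + j = m) {v : V} (hv0 : Q v = 0)
    (hv : v ∉ perp Q α) :
    {W | W ∈ hyperplaneGenerators Q m α ∧ v ∈ switchedGenerator Q α W}.ncard =
      ∏ i ∈ Finset.range j, (2 ^ (δ + i) + 1) := by
  simp only [mem_switchedGenerator_of_notMem_perp hv]
  set K := α ⊓ perp Q (Submodule.span (ZMod 2) {v}) with hK
  have hKd : Module.finrank (ZMod 2) K + 1 = Module.finrank (ZMod 2) α :=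
    finrank_inf_perp_singleton hv
  have hKmem : K ∈ hyperplanesThrough ⊥ α := ⟨⟨bot_le, inf_le_left⟩, hKd⟩
  have hvK : v ∉ K := fun h => hv (hα.le_perp h.1)
  have hd := finrank_sup_singleton hvK
  have hc : Contained Q (K ⊔ Submodule.span (ZMod 2) {v}) :=
    (hα.mono inf_le_left).sup_singleton hv0
      (mem_perp'.2 fun w hw => mem_perp_span_singleton.1 hw.2)
  rw [← ncard_generatorsThrough hQ hm hδ hc (j := j) (by omega), ← generatorsThrough_and_mem]
  congr 1
  ext W
  constructor
  · rintro ⟨hW, hvW⟩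
    refine ⟨⟨hW.1, ?_⟩, hvW⟩
    have h1 : α ⊓ W ≤ K := le_inf inf_le_left fun w hw =>
      mem_perp_span_singleton.2 (hW.1.1.polar_eq_zero hvW hw.2)
    have h2 := hW.2
    rw [← Submodule.eq_of_le_of_finrank_eq h1 (by omega)]
    exact inf_le_right
  · rintro ⟨⟨hW, hKW⟩, hvW⟩
    have hαW : ¬ α ≤ W := fun h => hv ((hW.1.le_perp.trans (perp_anti h)) hvW)
    refine ⟨⟨hW, ?_⟩, hvW⟩
    rw [inf_eq_of_mem_hyperplanesThrough hKmem hKW hαW]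
    exact hKd

/-- The number of maximum cliques through each vertex, in terms of the Witt index
`m = s + j + 2` and the dimension `δ` of an anisotropic kernel. -/
theorem numMaxCliquesThrough_formulas (hQ : Nonsingular Q) {m δ s j : ℕ} (hm : HasWittIndex Q m)
    (hδ : Module.finrank (ZMod 2) V = 2 * m + δ) (hα : Contained Q α)
    (hs : Module.finrank (ZMod 2) α = s + 1) (hj : m = s + j + 2) (x : Point Q) :
    (TypeI α x → (numMaxCliquesThrough Q α x : ℤ) =
      (∏ i ∈ Finset.range (j + 1), (2 ^ (δ + i) + 1 : ℤ)) *
        (2 ^ (s + j + 1 + δ) - 2 ^ (j + 1 + δ) + 1)) ∧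
    (TypeII α x → (numMaxCliquesThrough Q α x : ℤ) =
      (∏ i ∈ Finset.range j, (2 ^ (δ + i) + 1 : ℤ)) * (2 ^ (s + j + 1 + δ) - 2 ^ (j + δ) + 1)) ∧
    (TypeIII α x → (numMaxCliquesThrough Q α x : ℤ) =
      ∏ i ∈ Finset.range (j + 1), (2 ^ (δ + i) + 1 : ℤ)) := by
  have hαm : Module.finrank (ZMod 2) α < m := by omega
  refine ⟨fun hx => ?_, fun hx => ?_, fun hx => ?_⟩
  · have hx' := typeI_iff.1 hx
    have h1 : {W | W ∈ generatorsThrough Q m α ∧ x.vec ∈ W} = generatorsThrough Q m α := by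
      ext W
      exact ⟨fun h => h.1, fun h => ⟨h, h.2 hx'⟩⟩
    rw [numMaxCliquesThrough_eq hQ hm hα hαm, h1,
      ncard_generatorsThrough hQ hm hδ hα (j := j + 1) (by omega),
      ncard_hyperplaneGenerators_of_mem hQ hm hδ hα (j := j + 1) (by omega) x.vec_ne_zero hx', hs,
      Nat.add_sub_cancel]
    push_cast [Nat.one_le_two_pow]
    ring
  · have hx' := (typeII_iff hα).1 hx
    have hd := finrank_sup_singleton hx'.2
    rw [numMaxCliquesThrough_eq hQ hm hα hαm, generatorsThrough_and_mem,
      ncard_generatorsThrough hQ hm hδ (hα.sup_singleton hx'.1.2 hx'.1.1) (j := j) (by omega),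
      ncard_hyperplaneGenerators_of_mem_tangentSet hQ hm hδ hα (j := j) (by omega) hx', hs]
    push_cast [Nat.one_le_two_pow]
    ring
  · have hx' := (typeIII_iff hα).1 hx
    have h1 : {W | W ∈ generatorsThrough Q m α ∧ x.vec ∈ W} = ∅ := by
      rw [Set.eq_empty_iff_forall_notMem]
      rintro W ⟨hW, hxW⟩
      exact hx' ((hW.1.1.le_perp.trans (perp_anti hW.2)) hxW)
    rw [numMaxCliquesThrough_eq hQ hm hα hαm, h1, Set.ncard_empty, zero_add,
      ncard_hyperplaneGenerators_of_notMem_perp hQ hm hδ hα (j := j + 1) (by omega) x.map_vec hx']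
    push_cast
    rfl

end Finite
end Count

end BinaryQuadric

open BinaryQuadric

theorem theorem4p8 {V : Type*} [AddCommGroup V] [Module (ZMod 2) V]
    [FiniteDimensional (ZMod 2) V] (Q : QuadraticForm (ZMod 2) V)
    (hQ : BinaryQuadric.Nonsingular Q) (g s r : ℕ)
    (hg : BinaryQuadric.HasProjectiveIndex Q (g : ℤ)) (hg1 : 1 ≤ g) (hs : s < g)
    (α : Submodule (ZMod 2) V) (hα : BinaryQuadric.Contained Q α)
    (hαdim : Module.finrank (ZMod 2) α = s + 1) (x : BinaryQuadric.Point Q) :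
    (BinaryQuadric.IsElliptic Q r →
      (BinaryQuadric.TypeI α x →
        (s + 1 < g → (BinaryQuadric.numMaxCliquesThrough Q α x : ℤ) =
          (∏ i ∈ Finset.Icc 2 (r - s), (2 ^ i + 1 : ℤ)) * (2 ^ (r + 1) - 2 ^ (r - s + 1) + 1)) ∧
        (s + 1 = g → (BinaryQuadric.numMaxCliquesThrough Q α x : ℤ) =
          5 * (2 ^ (r + 1) - 7))) ∧
      (BinaryQuadric.TypeII α x →
        (s + 1 < g → (BinaryQuadric.numMaxCliquesThrough Q α x : ℤ) =
          (∏ i ∈ Finset.Icc 2 (r - s - 1), (2 ^ i + 1 : ℤ)) * (2 ^ (r + 1) - 2 ^ (r - s) + 1)) ∧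
        (s + 1 = g → (BinaryQuadric.numMaxCliquesThrough Q α x : ℤ) =
          2 ^ (r + 1) - 3)) ∧
      (BinaryQuadric.TypeIII α x →
        (s + 1 < g → (BinaryQuadric.numMaxCliquesThrough Q α x : ℤ) =
          ∏ i ∈ Finset.Icc 2 (r - s), (2 ^ i + 1 : ℤ)) ∧
        (s + 1 = g → (BinaryQuadric.numMaxCliquesThrough Q α x : ℤ) = 5))) ∧
    (BinaryQuadric.IsHyperbolic Q r →
      (BinaryQuadric.TypeI α x →
        (s + 1 < g → (BinaryQuadric.numMaxCliquesThrough Q α x : ℤ) =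
          (∏ i ∈ Finset.Icc 0 (r - s - 1), (2 ^ i + 1 : ℤ)) * (2 ^ r - 2 ^ (r - s) + 1)) ∧
        (s + 1 = g → (BinaryQuadric.numMaxCliquesThrough Q α x : ℤ) =
          2 * (2 ^ r - 1))) ∧
      (BinaryQuadric.TypeII α x →
        (s + 1 < g → (BinaryQuadric.numMaxCliquesThrough Q α x : ℤ) =
          (∏ i ∈ Finset.Icc 0 (r - s - 2), (2 ^ i + 1 : ℤ)) * (2 ^ r - 2 ^ (r - s - 1) + 1)) ∧
        (s + 1 = g → (BinaryQuadric.numMaxCliquesThrough Q α x : ℤ) = 2 ^ r)) ∧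
      (BinaryQuadric.TypeIII α x →
        (s + 1 < g → (BinaryQuadric.numMaxCliquesThrough Q α x : ℤ) =
          ∏ i ∈ Finset.Icc 0 (r - s - 1), (2 ^ i + 1 : ℤ)) ∧
        (s + 1 = g → (BinaryQuadric.numMaxCliquesThrough Q α x : ℤ) = 2))) ∧
    (BinaryQuadric.IsParabolic Q r →
      (BinaryQuadric.TypeI α x →
        (s + 1 < g → (BinaryQuadric.numMaxCliquesThrough Q α x : ℤ) =
          (∏ i ∈ Finset.Icc 1 (r - s - 1), (2 ^ i + 1 : ℤ)) * (2 ^ r - 2 ^ (r - s) + 1)) ∧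
        (s + 1 = g → (BinaryQuadric.numMaxCliquesThrough Q α x : ℤ) =
          3 * (2 ^ r - 3))) ∧
      (BinaryQuadric.TypeII α x →
        (s + 1 < g → (BinaryQuadric.numMaxCliquesThrough Q α x : ℤ) =
          (∏ i ∈ Finset.Icc 1 (r - s - 2), (2 ^ i + 1 : ℤ)) * (2 ^ r - 2 ^ (r - s - 1) + 1)) ∧
        (s + 1 = g → (BinaryQuadric.numMaxCliquesThrough Q α x : ℤ) = 2 ^ r - 1)) ∧
      (BinaryQuadric.TypeIII α x →
        (s + 1 < g → (BinaryQuadric.numMaxCliquesThrough Q α x : ℤ) =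
          ∏ i ∈ Finset.Icc 1 (r - s - 1), (2 ^ i + 1 : ℤ)) ∧
        (s + 1 = g → (BinaryQuadric.numMaxCliquesThrough Q α x : ℤ) = 3))) := by
  obtain ⟨j, rfl⟩ : ∃ j, g = s + 1 + j := ⟨g - (s + 1), by omega⟩
  have hm := hg.hasWittIndex
  refine ⟨fun h => ?_, fun h => ?_, fun h => ?_⟩
  · have hr : r = s + j + 2 := by
      have := hg.unique h.index
      omega
    have hd := h.finrank_eq
    subst hr
    obtain ⟨h1, h2, h3⟩ := numMaxCliquesThrough_formulas hQ hm (δ := 2) (j := j) (by omega) hα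
      hαdim (by omega) x
    have e1 : s + j + 2 - s = j + 2 := by omega
    have e2 : j + 2 - 1 = j + 1 := by omega
    rw [e1, e2, prod_Icc_eq_prod_range (j := j + 1) (by omega),
      prod_Icc_eq_prod_range (j := j) (by omega)]
    refine ⟨fun hx => ⟨fun _ => ?_, fun hj => ?_⟩, fun hx => ⟨fun _ => ?_, fun hj => ?_⟩,
      fun hx => ⟨fun _ => h3 hx, fun hj => ?_⟩⟩
    · rw [h1 hx]
    · obtain rfl : j = 0 := by omega
      rw [h1 hx]; norm_num; ring
    · rw [h2 hx]
    · obtain rfl : j = 0 := by omega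
      rw [h2 hx]; norm_num; ring
    · obtain rfl : j = 0 := by omega
      rw [h3 hx]; norm_num
  · have hr : r = s + j + 1 := by
      have := hg.unique h.index
      omega
    have hd := h.finrank_eq
    subst hr
    obtain ⟨h1, h2, h3⟩ := numMaxCliquesThrough_formulas hQ hm (δ := 0) (j := j) (by omega) hα
      hαdim (by omega) x
    have e1 : s + j + 1 - s = j + 1 := by omega
    rw [e1, Nat.add_sub_cancel, prod_Icc_eq_prod_range (a := 0) (n := j) (j := j + 1) (by omega)]
    refine ⟨fun hx => ⟨fun _ => ?_, fun hj => ?_⟩, fun hx => ⟨fun hj => ?_, fun hj => ?_⟩,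
      fun hx => ⟨fun _ => h3 hx, fun hj => ?_⟩⟩
    · rw [h1 hx]
    · obtain rfl : j = 0 := by omega
      rw [h1 hx]; norm_num; ring
    · rw [h2 hx, prod_Icc_eq_prod_range (j := j) (by omega)]; ring
    · obtain rfl : j = 0 := by omega
      rw [h2 hx]; norm_num
    · obtain rfl : j = 0 := by omega
      rw [h3 hx]; norm_num
  · -- The dimension is odd and exceeds twice the Witt index by at most two.
    have hd := h.finrank_eq
    have hlow : 2 * (s + 1 + j + 1) ≤ Module.finrank (ZMod 2) V := by
      obtain ⟨W, hW, hWm⟩ := hm.exists_contained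
      have h1 := finrank_add_finrank_perp hQ hW
      have h2 := Submodule.finrank_mono hW.le_perp
      omega
    have hhigh := hm.finrank_le_add_two hQ
    have hr : r = s + j + 2 := by omega
    subst hr
    obtain ⟨h1, h2, h3⟩ := numMaxCliquesThrough_formulas hQ hm (δ := 1) (j := j) (by omega) hα
      hαdim (by omega) x
    have e1 : s + j + 2 - s = j + 2 := by omega
    have e2 : j + 2 - 1 = j + 1 := by omega
    have e3 : j + 2 - 2 = j := by omega
    rw [e1, e2, e3, prod_Icc_eq_prod_range (j := j + 1) (by omega),
      prod_Icc_eq_prod_range (j := j) (by omega)]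
    refine ⟨fun hx => ⟨fun _ => ?_, fun hj => ?_⟩, fun hx => ⟨fun _ => ?_, fun hj => ?_⟩,
      fun hx => ⟨fun _ => h3 hx, fun hj => ?_⟩⟩
    · rw [h1 hx]
    · obtain rfl : j = 0 := by omega
      rw [h1 hx]; norm_num; ring
    · rw [h2 hx]
    · obtain rfl : j = 0 := by omega
      rw [h2 hx]; norm_num; ring
    · obtain rfl : j = 0 := by omega
      rw [h3 hx]; norm_num
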